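/- Let $R$ be a commutative ring, $n\ge 0$, and let $\mathcal C$ be an ordinary disk-like $n$-category enriched in $R$-modules: functors $\mathcal C_k$ ($0\le k\le n$) from $k$-balls and homeomorphisms to sets, with boundary maps $\mathcal C(X)\to\underline{\mathcal C}(\partial X)$, strictly associative gluing of balls along balls (injective for $k<n$), product morphisms for pinched products, and extended isotopy invariance in dimension $n$ (homeomorphisms isotopic to the identity rel boundary and collar maps act trivially), such that for every $n$-ball $X$ and $\beta\in\underline{\mathcal C}(\partial X)$ the set $\mathcal C(X;\beta)$ of morphisms with boundary $\beta$ is an $R$-module and the structure maps are (multi)linear. Here, for a closed manifold $N$ of dimension $<n$, $\underline{\mathcal C}(N)$ is the colimit, over the permissible decompositions of $N$, of the sets of labellings of the balls by morphisms whose restrictions to shared boundaries agree. Let $W$ be a topological $n$-manifold, possibly with boundary, and let $c\in\underline{\mathcal C}(\partial W)$. Let $\mathfrak D(W)$ be the poset of permissible decompositions $x:\coprod_a X_a\to W$ into $n$-balls (those that can be completed to a finite sequence of gluings of manifolds $\coprod_a X_a=M_0\to M_1\to\dots\to M_m=W$), where $x\le y$ if $y$ arises from $x$ by a finite sequence of gluings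 all of whose stages are disjoint unions of balls. Let $\psi=\psi_{\mathcal C;W,c}:\mathfrak D(W)\to R\text{-}\mathrm{Mod}$ be the functor $$\psi(x)=\bigoplus_{\beta}\bigotimes_a \mathcal C(X_a;\beta_a),$$ where $\beta$ runs over the families of boundary conditions $\beta_a\in\underline{\mathcal C}(\partial X_a)$ that agree on shared boundaries and restrict to $c$ on $\partial W$, with the maps $\psi(x)\to\psi(y)$ for $x\le y$ given by the composition (gluing) maps of $\mathcal C$. Let the blob complex $\mathcal B_*(W;\mathcal C)$ with boundary condition $c$ be the homotopy colimit of $\psi$, that is, $$\mathcal B_m=\bigoplus_{x_0\le\dots\le x_m}\psi(x_0),\qquad \partial(\bar x,a)=(d_0\bar x,\psi(x_0\le x_1)a)+\sum_{i=1}^m(-1)^i(d_i\bar x,a).$$ Then the zeroth homology of the blob complex is isomorphic to the skein module of $W$ (the usual (dual) TQFT vector space), that is, to the colimit of $\mathcal C$ along permissible decompositions of $W$: $$H_0(\mathcal B_*(W;\mathcal C))\;\cong\;\underline{\mathcal C}(W;c)=\operatorname*{colim}_{x\in\mathfrak D(W)}\psi(x),$$ by the isomorphism that sends the class of $a\in\psi(x)\subset\mathcal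 B_0$ to the image of $a$ in the colimit. -/

import Mathlib

open CategoryTheory Topology

universe u v w

noncomputable section

namespace DiskLike

/-! ## Balls, manifolds, boundaries -/

/-- A `k`-ball: a topological space homeomorphic to the standard closed `k`-ball. -/
structure Ball (k : ℕ) : Type (u + 1) where
  carrier : Type u
  [top : TopologicalSpace carrier]
  isBall : Nonempty (carrier ≃ₜ Metric.closedBall (0 : EuclideanSpace ℝ (Fin k)) 1)

instance (k : ℕ) : CoeSort (Ball.{u} k) (Type u) := ⟨Ball.carrier⟩

instance {k : ℕ} (X : Ball.{u} k) : TopologicalSpace X := X.top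

/-- The boundary of a `k`-manifold: the points without a neighbourhood homeomorphic to `ℝᵏ`. -/
def bd (k : ℕ) (X : Type u) [TopologicalSpace X] : Set X :=
  {x | ¬ ∃ U : Set X, IsOpen U ∧ x ∈ U ∧ Nonempty (U ≃ₜ EuclideanSpace ℝ (Fin k))}

/-- The half space of points of `ℝᵏ` whose first coordinate (if there is one) is nonnegative. -/
def halfSpace (k : ℕ) : Set (EuclideanSpace ℝ (Fin k)) :=
  {x | ∀ i : Fin k, (i : ℕ) = 0 → 0 ≤ x i}

/-- Topological `k`-manifolds, possibly with boundary. -/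
structure IsMfd (k : ℕ) (X : Type u) [TopologicalSpace X] : Prop where
  t2 : T2Space X
  secondCountable : SecondCountableTopology X
  chart : ∀ x : X, ∃ U : Set X, IsOpen U ∧ x ∈ U ∧
    ∃ V : Set (halfSpace k), IsOpen V ∧ Nonempty (U ≃ₜ V)

/-- `S` is a (closed, locally flat) codimension zero submanifold of the `d`-manifold `T`, where
`T` has no boundary. -/
def IsCodimZero (d : ℕ) {T : Type u} [TopologicalSpace T] (S : Set T) : Prop :=
  IsClosed S ∧ ∀ y ∈ frontier S, ∃ (U : Set T) (V : Set (EuclideanSpace ℝ (Fin d))) (h : U ≃ₜ V),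
    IsOpen U ∧ IsOpen V ∧ y ∈ U ∧
      ∀ z : U, (z : T) ∈ S ↔ (h z : EuclideanSpace ℝ (Fin d)) ∈ halfSpace d

/-- `q : M → N` is a gluing of `k`-manifolds: `N` is the quotient of `M` by a homeomorphism `φ`
between two disjoint codimension zero submanifolds `Y`, `Y'` of `∂M`. -/
def IsGluing (k : ℕ) {M N : Type u} [TopologicalSpace M] [TopologicalSpace N] (q : M → N) : Prop :=
  IsMfd k M ∧ IsMfd k N ∧ IsQuotientMap q ∧
  ∃ (Y Y' : Set (bd k M)) (φ : Y ≃ₜ Y'),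
    IsCodimZero (k - 1) Y ∧ IsCodimZero (k - 1) Y' ∧ Disjoint Y Y' ∧
    ∀ x x' : M, q x = q x' ↔ x = x' ∨
      (∃ y : Y, x = ((y : bd k M) : M) ∧ x' = ((φ y : bd k M) : M)) ∨
      (∃ y : Y, x' = ((y : bd k M) : M) ∧ x = ((φ y : bd k M) : M))

/-- `p : M → W` is (up to homeomorphism) the composite of a finite sequence of gluings
`M = M₀ → M₁ → ⋯ → Mₘ = W` of `k`-manifolds. -/
inductive GluesUp (k : ℕ) : ∀ {M W : Type u} [TopologicalSpace M] [TopologicalSpace W],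
    (M → W) → Prop
  | homeo {M W : Type u} [TopologicalSpace M] [TopologicalSpace W] (h : M ≃ₜ W)
      (hM : IsMfd k M) : GluesUp k (h : M → W)
  | step {M N W : Type u} [TopologicalSpace M] [TopologicalSpace N] [TopologicalSpace W]
      (q : M → N) (r : N → W) (hq : IsGluing k q) (hr : GluesUp k r) : GluesUp k (r ∘ q)

/-! ## Families of balls and decompositions -/

/-- A family of `k`-balls. -/
structure Fam (k : ℕ) : Type (u + 1) where
  ι : Type u
  X : ι → Ball.{u} k

/-- The disjoint union of a family of balls. -/
abbrev Fam.Tot {k : ℕ} (F : Fam.{u} k) : Type u := Σ i, F.X i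

/-- A decomposition of a sphere (or, a priori, of any space) `S` into two `d`-balls which meet
exactly along their common boundary: `S = A ∪_E A'` with `E = ∂A = ∂A'`. -/
structure SphereSplit (d : ℕ) (S : Type u) [TopologicalSpace S] (A A' : Ball.{u} d) :
    Type u where
  l : A → S
  r : A' → S
  l_cont : Continuous l
  r_cont : Continuous r
  l_inj : Function.Injective l
  r_inj : Function.Injective r
  cover : Set.range l ∪ Set.range r = Set.univ
  inter : Set.range l ∩ Set.range r = l '' bd d A
  inter' : Set.range l ∩ Set.range r = r '' bd d A'

/-- A gluing of two `k`-balls to a `k`-ball, `B = B₁ ∪_Y B₂`, along a `(k-1)`-ball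
`Y = B₁ ∩ B₂`, with `∂B₁ = Y ∪_E Z₁`, `∂B₂ = Y ∪_E Z₂` and `∂B = Z₁ ∪_E Z₂`, `E = ∂Y`.
(For `k = 0` there are no such gluings, since `∂B₁` is empty and `Y` is not.) -/
structure BallGluing {k : ℕ} (B₁ B₂ B : Ball.{u} k) : Type (u + 1) where
  j₁ : B₁ → B
  j₂ : B₂ → B
  j₁_cont : Continuous j₁
  j₂_cont : Continuous j₂
  j₁_inj : Function.Injective j₁
  j₂_inj : Function.Injective j₂
  cover : Set.range j₁ ∪ Set.range j₂ = Set.univ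
  Y : Ball.{u} (k - 1)
  Z₁ : Ball.{u} (k - 1)
  Z₂ : Ball.{u} (k - 1)
  s₁ : SphereSplit (k - 1) (bd k B₁) Y Z₁
  s₂ : SphereSplit (k - 1) (bd k B₂) Y Z₂
  s : SphereSplit (k - 1) (bd k B) Z₁ Z₂
  meet : ∀ x₁ x₂, j₁ x₁ = j₂ x₂ ↔ ∃ y : Y, x₁ = (s₁.l y : B₁) ∧ x₂ = (s₂.l y : B₂)
  bd₁ : ∀ z : Z₁, (s.l z : B) = j₁ (s₁.r z)
  bd₂ : ∀ z : Z₂, (s.r z : B) = j₂ (s₂.r z)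

/-- The map `g : ⊔ₐ Xₐ → ⊔_b Y_b` between disjoint unions of balls is one step of gluing balls:
each `Y_b` is either a homeomorphic copy of one `Xₐ`, or is glued together from two of them. -/
def BStep {k : ℕ} (F G : Fam.{u} k) (g : F.Tot → G.Tot) : Prop :=
  ∀ b : G.ι,
    (∃ (a : F.ι) (h : F.X a ≃ₜ G.X b), (∀ x, g ⟨a, x⟩ = ⟨b, h x⟩) ∧
      ∀ z : F.Tot, (g z).1 = b → z.1 = a) ∨
    (∃ (a₁ a₂ : F.ι) (D : BallGluing (F.X a₁) (F.X a₂) (G.X b)), a₁ ≠ a₂ ∧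
      (∀ x, g ⟨a₁, x⟩ = ⟨b, D.j₁ x⟩) ∧ (∀ x, g ⟨a₂, x⟩ = ⟨b, D.j₂ x⟩) ∧
      ∀ z : F.Tot, (g z).1 = b → z.1 = a₁ ∨ z.1 = a₂)

/-- Permissible decompositions `⊔ₐ Xₐ → W` of a `k`-manifold `W`: maps which can be completed to
a ball decomposition `⊔ₐ Xₐ = M₀ → ⋯ → Mₘ = W`. -/
structure Dec (k : ℕ) (W : Type u) [TopologicalSpace W] : Type (u + 1) where
  F : Fam.{u} k
  p : F.Tot → W
  perm : GluesUp k p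

/-- `y` is obtained from `x` by one step of gluing balls to balls. -/
def Dec.Step {k : ℕ} {W : Type u} [TopologicalSpace W] (x y : Dec k W) : Prop :=
  ∃ g, BStep x.F y.F g ∧ y.p ∘ g = x.p

/-- `x ≤ y` if `x` is a refinement of `y`, that is, `y` arises from `x` by a finite sequence of
gluings all of whose stages are disjoint unions of balls. -/
instance {k : ℕ} {W : Type u} [TopologicalSpace W] : Preorder (Dec k W) where
  le := Relation.ReflTransGen Dec.Step
  le_refl _ := Relation.ReflTransGen.refl
  le_trans _ _ _ := Relation.ReflTransGen.trans

/-! ## Pinched products -/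

/-- Pinched products `π : E → X` of an `l`-ball `E` over a `k`-ball `X`, `k < l`: continuous maps
that are, locally over `X`, modelled on an (iterated) degeneracy map `Δˡ → Δᵏ` of standard
simplices. -/
structure PinchedProduct {l k : ℕ} (E : Ball.{u} l) (X : Ball.{u} k) : Type u where
  π : E → X
  lt : k < l
  cont : Continuous π
  model : ∀ x : X, ∃ (V : Set X) (σ : Fin (l + 1) →o Fin (k + 1))
    (V' : Set (stdSimplex ℝ (Fin (k + 1)))) (h : V ≃ₜ V')
    (H : (π ⁻¹' V) ≃ₜ ((stdSimplex.map σ : stdSimplex ℝ (Fin (l + 1)) → _) ⁻¹' V')),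
    IsOpen V ∧ x ∈ V ∧ Function.Surjective σ ∧ IsOpen V' ∧
    ∀ z : (π ⁻¹' V), (h ⟨π z, z.2⟩ : stdSimplex ℝ (Fin (k + 1))) = stdSimplex.map σ (H z).1

/-- The composite of two pinched products, given that it is again a pinched product. -/
def PinchedProduct.IsComp {m l k : ℕ} {D : Ball.{u} m} {E : Ball.{u} l} {X : Ball.{u} k}
    (τ : PinchedProduct D X) (ρ : PinchedProduct D E) (π : PinchedProduct E X) : Prop :=
  ∀ z, τ.π z = π.π (ρ.π z)

/-! ## The raw data of a disk-like category -/

/-- A decomposition of `M` (a priori an arbitrary map to `M` from a disjoint union of balls) with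
the balls labelled by morphisms. -/
structure LDec (Mor : ∀ k, Ball.{u} k → Type v) (k : ℕ) (M : Type u) : Type (max (u + 1) v) where
  F : Fam.{u} k
  p : F.Tot → M
  e : ∀ i, Mor k (F.X i)

/-- Transport of a labelled decomposition along a map `M → M'`. -/
def LDec.push {Mor : ∀ k, Ball.{u} k → Type v} {k : ℕ} {M M' : Type u} (f : M → M')
    (L : LDec Mor k M) : LDec Mor k M' :=
  ⟨L.F, f ∘ L.p, L.e⟩

/-- The labelled decomposition with two pieces given by a splitting of a sphere. -/
def SphereSplit.pair {Mor : ∀ k, Ball.{u} k → Type v} {d : ℕ} {S : Type u} [TopologicalSpace S]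
    {A A' : Ball.{u} d} (s : SphereSplit d S A A') (a : Mor d A) (a' : Mor d A') : LDec Mor d S where
  F := ⟨PUnit.{u+1} ⊕ PUnit.{u+1}, Sum.elim (fun _ => A) (fun _ => A')⟩
  p := fun z => match z with
    | ⟨Sum.inl _, x⟩ => s.l x
    | ⟨Sum.inr _, x⟩ => s.r x
  e := fun i => match i with
    | Sum.inl _ => a
    | Sum.inr _ => a'

/-- The data of a disk-like category: morphisms, the action of homeomorphisms, boundary, gluing
and product morphisms. The boundary of a morphism `c` on a `k`-ball `X` is given by the relation
`bdry c L`: "`∂c` is represented by the labelled decomposition `L` of `∂X`"; it is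
single-valued as an element of the colimit over decompositions of `∂X` by an axiom below.
Gluing is given by the graph `glue D c₁ c₂ c`: "`c₁` and `c₂` can be glued along `D`, and the
result is `c`". (For `k = 0` the boundary `∂X` is empty, and it has only the empty decomposition,
in whatever dimension, so that the truncated `k - 1` is harmless.) -/
structure RawCat : Type (max (u + 1) (v + 1)) where
  Mor : ∀ k, Ball.{u} k → Type v
  act : ∀ {k} {X X' : Ball.{u} k}, (X ≃ₜ X') → Mor k X → Mor k X'
  bdry : ∀ {k} {X : Ball.{u} k}, Mor k X → LDec Mor (k - 1) (bd k X) → Prop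
  glue : ∀ {k} {B₁ B₂ B : Ball.{u} k}, BallGluing B₁ B₂ B → Mor k B₁ → Mor k B₂ → Mor k B → Prop
  pull : ∀ {l k} {E : Ball.{u} l} {X : Ball.{u} k}, PinchedProduct E X → Mor k X → Mor l E

namespace RawCat

variable (C : RawCat.{u, v})

/-- Labelled decompositions in `C`. -/
abbrev LD (k : ℕ) (M : Type u) : Type (max (u + 1) v) := LDec C.Mor k M

/-- Labellings of a family of balls by morphisms. -/
abbrev Lab {k : ℕ} (F : Fam.{u} k) : Type (max u v) := ∀ i, C.Mor k (F.X i)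

/-- `m` is the label induced on `Y_b` by one step of gluing of balls labelled by `e`. -/
def LPiece {k : ℕ} {F : Fam.{u} k} (e : C.Lab F) {G : Fam.{u} k} (g : F.Tot → G.Tot)
    (b : G.ι) (m : C.Mor k (G.X b)) : Prop :=
  (∃ (a : F.ι) (h : F.X a ≃ₜ G.X b), (∀ x, g ⟨a, x⟩ = ⟨b, h x⟩) ∧
    (∀ z : F.Tot, (g z).1 = b → z.1 = a) ∧ C.act h (e a) = m) ∨
  (∃ (a₁ a₂ : F.ι) (D : BallGluing (F.X a₁) (F.X a₂) (G.X b)), a₁ ≠ a₂ ∧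
    (∀ x, g ⟨a₁, x⟩ = ⟨b, D.j₁ x⟩) ∧ (∀ x, g ⟨a₂, x⟩ = ⟨b, D.j₂ x⟩) ∧
    (∀ z : F.Tot, (g z).1 = b → z.1 = a₁ ∨ z.1 = a₂) ∧ C.glue D (e a₁) (e a₂) m)

/-- One step of gluing labelled balls. -/
def LStep {k : ℕ} {F : Fam.{u} k} (e : C.Lab F) {G : Fam.{u} k} (e' : C.Lab G)
    (g : F.Tot → G.Tot) : Prop :=
  ∀ b, C.LPiece e g b (e' b)

/-- Sequences of gluings of labelled balls, with all stages disjoint unions of balls. -/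
inductive LSeq {k : ℕ} : ∀ {F : Fam.{u} k} (_ : C.Lab F) {G : Fam.{u} k} (_ : C.Lab G)
    (_ : F.Tot → G.Tot), Prop
  | refl {F : Fam.{u} k} (e : C.Lab F) : LSeq e e id
  | tail {F G H : Fam.{u} k} {e : C.Lab F} {e' : C.Lab G} {e'' : C.Lab H}
      {g : F.Tot → G.Tot} {g' : G.Tot → H.Tot} :
      LSeq e e' g → C.LStep e' e'' g' → LSeq e e'' (g' ∘ g)

variable {C}

/-- One step of gluing, on labelled permissible decompositions of `M`. -/
def StepTo {k : ℕ} {M : Type u} [TopologicalSpace M] (L L' : C.LD k M) : Prop :=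
  ∃ g, C.LStep L.e L'.e g ∧ L'.p ∘ g = L.p ∧ GluesUp k L'.p

/-- A labelled collection of `d`-balls in `M` (walls) in which two balls whose interiors overlap in
`M` coincide, and carry the same label. -/
def Cellular {d : ℕ} {M : Type u} (N : C.LD d M) : Prop :=
  (∀ t, Set.InjOn (fun x => N.p ⟨t, x⟩) (bd d (N.F.X t))ᶜ) ∧
  ∀ s t, (∃ x ∈ (bd d (N.F.X s))ᶜ, ∃ y ∈ (bd d (N.F.X t))ᶜ, N.p ⟨s, x⟩ = N.p ⟨t, y⟩) →
    ∃ h : N.F.X s ≃ₜ N.F.X t, (∀ x, N.p ⟨t, h x⟩ = N.p ⟨s, x⟩) ∧ C.act h (N.e s) = N.e t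

/-- All the walls in `M` coming from labelled decompositions `K i` of the boundaries of the balls
of a decomposition of `M`, together with those of a labelled decomposition `Lc` of `∂M`. -/
def walls {k : ℕ} {M : Type u} [TopologicalSpace M] {F : Fam.{u} k} (p : F.Tot → M)
    (K : ∀ i, C.LD (k - 1) (bd k (F.X i))) (Lc : C.LD (k - 1) (bd k M)) : C.LD (k - 1) M where
  F := ⟨(Σ i, (K i).F.ι) ⊕ Lc.F.ι, Sum.elim (fun s => (K s.1).F.X s.2) Lc.F.X⟩
  p := fun z => match z with
    | ⟨Sum.inl s, x⟩ => p ⟨s.1, ((K s.1).p ⟨s.2, x⟩ : F.X s.1)⟩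
    | ⟨Sum.inr t, x⟩ => (Lc.p ⟨t, x⟩ : M)
  e := fun t => match t with
    | Sum.inl s => (K s.1).e s.2
    | Sum.inr t => Lc.e t

/-- The boundaries of the labels of `L` split along pieces such that the restrictions to pieces
shared by several balls agree, and the restrictions to pieces of `∂M` form `Lc`. -/
def Agree {k : ℕ} {M : Type u} [TopologicalSpace M] (L : C.LD k M)
    (Lc : C.LD (k - 1) (bd k M)) : Prop :=
  ∃ K : ∀ i, C.LD (k - 1) (bd k (L.F.X i)), (∀ i, C.bdry (L.e i) (K i)) ∧ Cellular (walls L.p K Lc)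

/-- `L` is a permissible decomposition of `M` with labels whose restrictions to shared boundaries
agree and which can be glued together along every refinement; `S` is the set of
allowed boundary values. -/
def Compat {k : ℕ} {M : Type u} [TopologicalSpace M] (L : C.LD k M)
    (S : Set (C.LD (k - 1) (bd k M))) : Prop :=
  GluesUp k L.p ∧ ∀ L' : C.LD k M, Relation.ReflTransGen StepTo L L' →
    (∃ Lc ∈ S, Agree L' Lc) ∧
    ∀ (G : Fam.{u} k) (q : G.Tot → M) (g : L'.F.Tot → G.Tot), GluesUp k q → q ∘ g = L'.p →
      BStep L'.F G g → ∃ e : C.Lab G, C.LStep L'.e e g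

variable (C)

/-- The extension of `C` to a manifold `N` without boundary, of dimension `k` less than the
dimension of the category: the colimit of the sets of compatible labellings along
the permissible decompositions of `N`. -/
def UC (k : ℕ) (N : Type u) [TopologicalSpace N] : Type (max (u + 1) v) :=
  Quot (fun L L' : {L : C.LD k N // Compat L Set.univ} => StepTo L.1 L'.1)

variable {C}

/-- The labelled decompositions that represent an element of the colimit. -/
def reps {k : ℕ} {N : Type u} [TopologicalSpace N] (β : C.UC k N) : Set (C.LD k N) :=
  {L | ∃ h, Quot.mk _ ⟨L, h⟩ = β}

variable (C)

/-- `C(X; β)`: the morphisms on the `k`-ball `X` with boundary `β`. -/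
@[ext]
structure Fib {k : ℕ} (X : Ball.{u} k) (β : C.UC (k - 1) (bd k X)) : Type v where
  val : C.Mor k X
  prop : {L | C.bdry val L} = reps β

/-- Product morphisms together with their degenerate case, in which the projection is a
homeomorphism: `b` is the pull back of `a` along `ρ : E → X`. -/
inductive PullRel : ∀ {l k : ℕ} {E : Ball.{u} l} {X : Ball.{u} k},
    (E → X) → C.Mor k X → C.Mor l E → Prop
  | pinched {l k : ℕ} {E : Ball.{u} l} {X : Ball.{u} k} (π : PinchedProduct E X) (a : C.Mor k X) :
      PullRel π.π a (C.pull π a)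
  | homeo {k : ℕ} {E X : Ball.{u} k} (h : E ≃ₜ X) (a : C.Mor k X) :
      PullRel h a (C.act h.symm a)

/-- The family with one member. -/
def single {k : ℕ} (X : Ball.{u} k) : Fam.{u} k := ⟨PUnit.{u+1}, fun _ => X⟩

/-- `a₁` is the restriction of `a` to the ball `X₁`, embedded in `X` by `i₁`: there is a
decomposition of `X` into balls, with `X₁` among them, and with labels that glue to `a`. -/
def Restr {k : ℕ} {X X₁ : Ball.{u} k} (a : C.Mor k X) (i₁ : X₁ → X) (a₁ : C.Mor k X₁) : Prop :=
  ∃ (F : Fam.{u} k) (e : C.Lab F) (g : F.Tot → (single X).Tot),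
    C.LSeq e (G := single X) (fun _ => a) g ∧
    ∃ (s : F.ι) (h : X₁ ≃ₜ F.X s), C.act h a₁ = e s ∧ ∀ x, g ⟨s, h x⟩ = ⟨PUnit.unit, i₁ x⟩

end RawCat

/-! ## Homeomorphisms and boundaries -/

theorem bd_homeo {k : ℕ} {X X' : Type u} [TopologicalSpace X] [TopologicalSpace X'] (f : X ≃ₜ X')
    (x : X) : x ∈ bd k X ↔ f x ∈ bd k X' := by
  have key : ∀ {A B : Type u} [TopologicalSpace A] [TopologicalSpace B] (f : A ≃ₜ B) (x : A),
      f x ∈ bd k B → x ∈ bd k A := by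
    intro A B _ _ f x hx ⟨U, hU, hxU, ⟨h⟩⟩
    exact hx ⟨f '' U, f.isOpenMap U hU, ⟨x, hxU, rfl⟩, ⟨(f.image U).symm.trans h⟩⟩
  refine ⟨fun h => key f.symm (f x) (by simpa using h), key f x⟩

/-- The homeomorphism `∂X ≃ ∂X'` induced by a homeomorphism `X ≃ X'`. -/
def bdMap {k : ℕ} {X X' : Type u} [TopologicalSpace X] [TopologicalSpace X'] (f : X ≃ₜ X') :
    bd k X ≃ₜ bd k X' :=
  f.subtype (fun x => bd_homeo f x)

/-! ## Ordinary disk-like n-categories -/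

open RawCat

/-- Ordinary (disk-like) `n`-categories, enriched in `R`-modules in the top dimension. Only the
data for balls of dimension at most `n` matter. -/
structure NCat (R : Type w) [CommRing R] (n : ℕ) extends RawCat.{u, v} where
  /- Morphisms: functors from `k`-balls and homeomorphisms to sets. -/
  act_refl : ∀ {k} (_ : k ≤ n) {X : Ball.{u} k} (c : Mor k X), act (Homeomorph.refl X) c = c
  act_trans : ∀ {k} (_ : k ≤ n) {X X' X'' : Ball.{u} k} (f : X ≃ₜ X') (f' : X' ≃ₜ X'')
    (c : Mor k X), act (f.trans f') c = act f' (act f c)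
  /- Boundaries: a natural map from morphisms on `X` to the extension of the category to `∂X`. -/
  bdry_class : ∀ {k} (_ : k ≤ n) {X : Ball.{u} k} (c : Mor k X),
    ∃ β : toRawCat.UC (k - 1) (bd k X), {L | bdry c L} = reps β
  bdry_nat : ∀ {k} (_ : k ≤ n) {X X' : Ball.{u} k} (f : X ≃ₜ X') (c : Mor k X)
    (L : LDec Mor (k - 1) (bd k X)), bdry c L → bdry (act f c) (L.push (bdMap f))
  /- Boundary from domain and range: for a `d`-sphere `S = B₁ ∪_E B₂`, `d < n`, morphisms on the
  hemispheres that agree on `E` give, injectively, an element of the extension to `S`. -/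
  hemi_compat : ∀ {d} (_ : d < n) {S : Type u} [TopologicalSpace S]
    (_ : Nonempty (S ≃ₜ Metric.sphere (0 : EuclideanSpace ℝ (Fin (d + 1))) 1))
    {B₁ B₂ : Ball.{u} d} (s : SphereSplit d S B₁ B₂) (b₁ : Mor d B₁) (b₂ : Mor d B₂)
    (φ : bd d B₁ ≃ₜ bd d B₂) (_ : ∀ x : bd d B₁, s.l x = s.r (φ x))
    (K : LDec Mor (d - 1) (bd d B₁)), bdry b₁ K → bdry b₂ (K.push φ) →
    Compat (C := toRawCat) (s.pair b₁ b₂) Set.univ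
  hemi_inj : ∀ {d} (_ : d < n) {S : Type u} [TopologicalSpace S]
    (_ : Nonempty (S ≃ₜ Metric.sphere (0 : EuclideanSpace ℝ (Fin (d + 1))) 1))
    {B₁ B₂ : Ball.{u} d} (s : SphereSplit d S B₁ B₂) (b₁ b₁' : Mor d B₁) (b₂ b₂' : Mor d B₂)
    (β : toRawCat.UC d S), s.pair b₁ b₂ ∈ reps β → s.pair b₁' b₂' ∈ reps β →
    b₁ = b₁' ∧ b₂ = b₂'
  /- Gluing: defined exactly on pairs whose boundaries split along `E = ∂Y` with equal
  restrictions to `Y`; single-valued; compatible with restriction to the boundary; natural;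
  injective below the top dimension. -/
  glue_iff : ∀ {k} (_ : k ≤ n) {B₁ B₂ B : Ball.{u} k} (D : BallGluing B₁ B₂ B) (c₁ : Mor k B₁)
    (c₂ : Mor k B₂), (∃ c, glue D c₁ c₂ c) ↔
      ∃ a b₁ b₂, bdry c₁ (D.s₁.pair a b₁) ∧ bdry c₂ (D.s₂.pair a b₂)
  glue_unique : ∀ {k} (_ : k ≤ n) {B₁ B₂ B : Ball.{u} k} (D : BallGluing B₁ B₂ B) (c₁ : Mor k B₁)
    (c₂ : Mor k B₂) (c c' : Mor k B), glue D c₁ c₂ c → glue D c₁ c₂ c' → c = c'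
  glue_bdry : ∀ {k} (_ : k ≤ n) {B₁ B₂ B : Ball.{u} k} (D : BallGluing B₁ B₂ B) (c₁ : Mor k B₁)
    (c₂ : Mor k B₂) (c : Mor k B) (a : Mor (k - 1) D.Y) (b₁ : Mor (k - 1) D.Z₁)
    (b₂ : Mor (k - 1) D.Z₂), glue D c₁ c₂ c → bdry c₁ (D.s₁.pair a b₁) →
      bdry c₂ (D.s₂.pair a b₂) → bdry c (D.s.pair b₁ b₂)
  glue_nat : ∀ {k} (_ : k ≤ n) {B₁ B₂ B B₁' B₂' B' : Ball.{u} k} (D : BallGluing B₁ B₂ B)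
    (D' : BallGluing B₁' B₂' B') (f₁ : B₁ ≃ₜ B₁') (f₂ : B₂ ≃ₜ B₂') (f : B ≃ₜ B')
    (_ : ∀ x, f (D.j₁ x) = D'.j₁ (f₁ x)) (_ : ∀ x, f (D.j₂ x) = D'.j₂ (f₂ x))
    (c₁ : Mor k B₁) (c₂ : Mor k B₂) (c : Mor k B),
    glue D c₁ c₂ c → glue D' (act f₁ c₁) (act f₂ c₂) (act f c)
  glue_inj : ∀ {k} (_ : k < n) {B₁ B₂ B : Ball.{u} k} (D : BallGluing B₁ B₂ B)
    (c₁ c₁' : Mor k B₁) (c₂ c₂' : Mor k B₂) (c : Mor k B),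
    glue D c₁ c₂ c → glue D c₁' c₂' c → c₁ = c₁' ∧ c₂ = c₂'
  /- Strict associativity: any two sequences of gluings of balls that realize the same
  decomposition of a disjoint union of balls yield the same result. -/
  assoc : ∀ {k} (_ : k ≤ n) {F G : Fam.{u} k} (e : toRawCat.Lab F) (e' e'' : toRawCat.Lab G)
    (g : F.Tot → G.Tot), toRawCat.LSeq e e' g → toRawCat.LSeq e e'' g → e' = e''
  /- Product morphisms: natural, functorial, compatible with gluing and with restriction. -/
  pull_nat : ∀ {l k} (_ : l ≤ n) {E E' : Ball.{u} l} {X X' : Ball.{u} k} (π : PinchedProduct E X)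
    (π' : PinchedProduct E' X') (f : X ≃ₜ X') (f' : E ≃ₜ E') (_ : ∀ z, π'.π (f' z) = f (π.π z))
    (a : Mor k X), pull π' (act f a) = act f' (pull π a)
  pull_comp : ∀ {m l k} (_ : m ≤ n) {D : Ball.{u} m} {E : Ball.{u} l} {X : Ball.{u} k}
    (τ : PinchedProduct D X) (ρ : PinchedProduct D E) (π : PinchedProduct E X) (_ : τ.IsComp ρ π)
    (a : Mor k X), pull τ a = pull ρ (pull π a)
  pull_glue : ∀ {l k} (_ : l ≤ n) {E E₁ E₂ : Ball.{u} l} {X X₁ X₂ : Ball.{u} k}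
    (π : PinchedProduct E X) (π₁ : PinchedProduct E₁ X₁) (π₂ : PinchedProduct E₂ X₂)
    (D : BallGluing E₁ E₂ E) (i₁ : X₁ → X) (i₂ : X₂ → X)
    (_ : ∀ z, π.π (D.j₁ z) = i₁ (π₁.π z)) (_ : ∀ z, π.π (D.j₂ z) = i₂ (π₂.π z))
    (a : Mor k X) (a₁ : Mor k X₁) (a₂ : Mor k X₂),
    toRawCat.Restr a i₁ a₁ → toRawCat.Restr a i₂ a₂ →
    glue D (pull π₁ a₁) (pull π₂ a₂) (pull π a)
  pull_restr : ∀ {l k} (_ : l ≤ n) {E : Ball.{u} l} {X : Ball.{u} k} (π : PinchedProduct E X)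
    (a : Mor k X) (K : LDec Mor (k - 1) (bd k X)) (T : LDec Mor (l - 1) (bd l E)),
    bdry a K → Compat (C := toRawCat) T Set.univ →
    (∀ t, (∃ (X₁ : Ball.{u} k) (i₁ : X₁ → X) (a₁ : Mor k X₁) (ρ : T.F.X t → X₁),
        toRawCat.Restr a i₁ a₁ ∧ (∀ z, i₁ (ρ z) = π.π (T.p ⟨t, z⟩ : E)) ∧
        toRawCat.PullRel ρ a₁ (T.e t)) ∨
      (∃ (s : K.F.ι) (ρ : T.F.X t → K.F.X s),
        (∀ z, ((K.p ⟨s, ρ z⟩ : bd k X) : X) = π.π (T.p ⟨t, z⟩ : E)) ∧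
        toRawCat.PullRel ρ (K.e s) (T.e t))) →
    bdry (pull π a) T
  /- Extended isotopy invariance in dimension `n`: homeomorphisms isotopic to the identity rel
  boundary act trivially, and so do collar maps. -/
  isotopy : ∀ {X : Ball.{u} n} (f : X ≃ₜ X) (H : unitInterval → (X ≃ₜ X))
    (_ : Continuous fun z : unitInterval × X => H z.1 z.2)
    (_ : ∀ t, ∀ x ∈ bd n X, H t x = x) (_ : H 0 = Homeomorph.refl X) (_ : H 1 = f)
    (c : Mor n X), act f c = c
  collar : ∀ {X P B : Ball.{u} n} (D : BallGluing X P B) (ρ : PinchedProduct P D.Y)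
    (q : D.Y × unitInterval → P) (_ : IsQuotientMap q)
    (_ : ∀ y y' s s', q (y, s) = q (y', s') ↔ y = y' ∧ (s = s' ∨ y ∈ bd (n - 1) D.Y))
    (_ : ∀ y s, ρ.π (q (y, s)) = y) (_ : ∀ y, (D.s₂.l y : P) = q (y, 0))
    (h : B ≃ₜ X) (_ : ∀ x : bd n X, x ∉ Set.range D.s₁.l → h (D.j₁ x) = x)
    (_ : ∀ y, h (D.j₂ (q (y, 1))) = (D.s₁.l y : X))
    (c : Mor n X) (a : Mor (n - 1) D.Y) (b : Mor (n - 1) D.Z₁) (c' : Mor n B),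
    bdry c (D.s₁.pair a b) → glue D c (pull ρ a) c' → act h c' = c
  /- Enrichment: the morphisms on an `n`-ball with given boundary form an `R`-module, and the
  structure maps are (multi)linear. -/
  addCommGroup : ∀ (X : Ball.{u} n) (β : toRawCat.UC (n - 1) (bd n X)),
    AddCommGroup (toRawCat.Fib X β)
  module : ∀ (X : Ball.{u} n) (β : toRawCat.UC (n - 1) (bd n X)), Module R (toRawCat.Fib X β)
  act_lin : ∀ {X X' : Ball.{u} n} (f : X ≃ₜ X') {β β'} (r s : R) (c d : toRawCat.Fib X β)
    (c' d' : toRawCat.Fib X' β'), act f c.1 = c'.1 → act f d.1 = d'.1 →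
    act f (r • c + s • d).1 = (r • c' + s • d').1
  glue_lin_left : ∀ {B₁ B₂ B : Ball.{u} n} (D : BallGluing B₁ B₂ B) {β β'} (r s : R)
    (c d : toRawCat.Fib B₁ β) (m : Mor n B₂) (c' d' : toRawCat.Fib B β'),
    glue D c.1 m c'.1 → glue D d.1 m d'.1 → glue D (r • c + s • d).1 m (r • c' + s • d').1
  glue_lin_right : ∀ {B₁ B₂ B : Ball.{u} n} (D : BallGluing B₁ B₂ B) {β β'} (r s : R)
    (m : Mor n B₁) (c d : toRawCat.Fib B₂ β) (c' d' : toRawCat.Fib B β'),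
    glue D m c.1 c'.1 → glue D m d.1 d'.1 → glue D m (r • c + s • d).1 (r • c' + s • d').1

attribute [instance] NCat.addCommGroup NCat.module

/-! ## Uniqueness of refinement maps -/

theorem not_bd_of_isOpenEmbedding {k : ℕ} {M N : Type u} [TopologicalSpace M] [TopologicalSpace N]
    {U : Set M} {q : M → N} (hq : IsOpenEmbedding (U.domRestrict q))
    (hk : Nonempty (U ≃ₜ EuclideanSpace ℝ (Fin k))) {x : M} (hx : x ∈ U) : q x ∉ bd k N := by
  obtain ⟨h⟩ := hk
  intro hn
  exact hn ⟨Set.range (U.domRestrict q), hq.isOpen_range, ⟨⟨x, hx⟩, rfl⟩,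
    ⟨hq.isEmbedding.toHomeomorph.symm.trans h⟩⟩

theorem not_bd_of_open {k : ℕ} {M : Type u} [TopologicalSpace M] {U : Set M} (hU : IsOpen U)
    (hk : Nonempty (U ≃ₜ EuclideanSpace ℝ (Fin k))) {x : M} (hx : x ∈ U) : x ∉ bd k M :=
  fun h => h ⟨U, hU, hx, hk⟩

theorem ball_int_dense {k : ℕ} (X : Ball.{u} k) : Dense (bd k X)ᶜ := by
  obtain ⟨h⟩ := X.isBall
  let D := Metric.closedBall (0 : EuclideanSpace ℝ (Fin k)) 1
  let U : Set D := {z | (z : EuclideanSpace ℝ (Fin k)) ∈ Metric.ball 0 1}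
  have hUo : IsOpen U := Metric.isOpen_ball.preimage continuous_subtype_val
  have hUd : Dense U := by
    rw [Subtype.dense_iff]
    intro z hz
    have : Subtype.val '' U = Metric.ball (0 : EuclideanSpace ℝ (Fin k)) 1 := by
      ext w
      constructor
      · rintro ⟨w', hw', rfl⟩
        exact hw'
      · intro hw
        exact ⟨⟨w, Metric.ball_subset_closedBall hw⟩, hw, rfl⟩
    rw [this, closure_ball _ one_ne_zero]
    exact hz
  have e : U ≃ₜ Metric.ball (0 : EuclideanSpace ℝ (Fin k)) 1 :=
    { toFun := fun z => ⟨z.1.1, z.2⟩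
      invFun := fun z => ⟨⟨z.1, Metric.ball_subset_closedBall z.2⟩, z.2⟩
      left_inv := fun _ => rfl
      right_inv := fun _ => rfl
      continuous_toFun := by fun_prop
      continuous_invFun := by fun_prop }
  refine (hUd.preimage h.isOpenMap).mono ?_
  intro x hx
  refine not_bd_of_open (hUo.preimage h.continuous) ?_ hx
  exact ⟨(h.sets (s := h ⁻¹' U) (t := U) rfl).trans (e.trans Homeomorph.unitBall.symm)⟩

theorem IsGluing.not_bd {k : ℕ} {M N : Type u} [TopologicalSpace M] [TopologicalSpace N]
    {q : M → N} (hq : IsGluing k q) {x : M} (hx : x ∉ bd k M) : q x ∉ bd k N := by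
  obtain ⟨-, -, hqq, Y, Y', φ, -, -, -, hrel⟩ := hq
  have inj : ∀ z z', z ∉ bd k M → q z = q z' → z = z' := by
    intro z z' hz hzz
    rcases (hrel z z').1 hzz with h | ⟨y, rfl, -⟩ | ⟨y, -, rfl⟩
    · exact h
    · exact absurd (y : bd k M).2 hz
    · exact absurd (φ y : bd k M).2 hz
  obtain ⟨U, hU, hxU, hk⟩ := not_not.1 hx
  have hUb : ∀ z ∈ U, z ∉ bd k M := fun z hz => not_bd_of_open hU hk hz
  refine not_bd_of_isOpenEmbedding (U := U) (IsOpenEmbedding.of_continuous_injective_isOpenMap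
    (hqq.continuous.comp continuous_subtype_val) ?_ ?_) hk hxU
  · intro a b hab
    exact Subtype.ext (inj _ _ (hUb _ a.2) hab)
  · intro V hV
    have hV' : IsOpen (Subtype.val '' V : Set M) := hU.isOpenMap_subtype_val V hV
    rw [← hqq.isOpen_preimage]
    convert hV' using 1
    ext z
    constructor
    · rintro ⟨v, hv, hvz⟩
      exact ⟨v, hv, inj _ _ (hUb _ v.2) hvz⟩
    · rintro ⟨v, hv, rfl⟩
      exact ⟨v, hv, rfl⟩

theorem GluesUp.inj {k : ℕ} {M W : Type u} [TopologicalSpace M] [TopologicalSpace W]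
    {p : M → W} (hp : GluesUp k p) : ∀ {x x' : M}, x ∉ bd k M → p x = p x' → x = x' := by
  induction hp with
  | homeo h hM => exact fun _ hxx => h.injective hxx
  | step q r hq hr ih =>
    intro x x' hx hxx
    have h1 := ih (hq.not_bd hx) hxx
    obtain ⟨-, -, -, Y, Y', φ, -, -, -, hrel⟩ := hq
    rcases (hrel x x').1 h1 with h | ⟨y, rfl, -⟩ | ⟨y, -, rfl⟩
    · exact h
    · exact absurd (Subtype.property (y.1)) hx
    · exact absurd (Subtype.property ((φ y).1)) hx

instance {k : ℕ} (X : Ball.{u} k) : T2Space X := by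
  obtain ⟨h⟩ := X.isBall
  exact h.isEmbedding.t2Space

instance {k : ℕ} (X : Ball.{u} k) : CompactSpace X := by
  obtain ⟨h⟩ := X.isBall
  have := isCompact_iff_compactSpace.1
    (isCompact_closedBall (0 : EuclideanSpace ℝ (Fin k)) 1)
  exact h.symm.compactSpace

instance {k : ℕ} (X : Ball.{u} k) : Nonempty X := by
  obtain ⟨h⟩ := X.isBall
  exact ⟨h.symm ⟨0, by simp⟩⟩

theorem BallGluing.not_bd₁ {k : ℕ} {B₁ B₂ B : Ball.{u} k} (D : BallGluing B₁ B₂ B) {x : B₁}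
    (hx : x ∉ bd k B₁) : D.j₁ x ∉ bd k B := by
  obtain ⟨U, hU, hxU, hk⟩ := not_not.1 hx
  have hUb : ∀ z ∈ U, z ∉ bd k B₁ := fun z hz => not_bd_of_open hU hk hz
  refine not_bd_of_isOpenEmbedding (U := U) (IsOpenEmbedding.of_continuous_injective_isOpenMap
    (D.j₁_cont.comp continuous_subtype_val)
    (D.j₁_inj.comp Subtype.val_injective) ?_) hk hxU
  intro V hV
  have hV' : IsOpen (Subtype.val '' V : Set B₁) := hU.isOpenMap_subtype_val V hV
  have : (U.domRestrict D.j₁ '' V) = (D.j₁ '' (Subtype.val '' V)ᶜ ∪ Set.range D.j₂)ᶜ := by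
    ext z
    simp only [Set.mem_compl_iff, Set.mem_union, not_or]
    constructor
    · rintro ⟨v, hv, rfl⟩
      refine ⟨?_, ?_⟩
      · rintro ⟨w, hw, hwv⟩
        exact hw ⟨v, hv, (D.j₁_inj hwv).symm⟩
      · rintro ⟨w, hw⟩
        obtain ⟨y, hy, -⟩ := (D.meet v w).1 hw.symm
        exact hUb _ v.2 (hy ▸ (D.s₁.l y).2)
    · rintro ⟨h1, h2⟩
      have hz : z ∈ Set.range D.j₁ ∪ Set.range D.j₂ := by rw [D.cover]; trivial
      rcases hz with ⟨w, rfl⟩ | hz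
      · by_cases hw : w ∈ (Subtype.val '' V : Set B₁)
        · obtain ⟨v, hv, rfl⟩ := hw
          exact ⟨v, hv, rfl⟩
        · exact absurd ⟨w, hw, rfl⟩ h1
      · exact absurd hz h2
  rw [this]
  refine IsClosed.isOpen_compl (self := ?_)
  refine IsClosed.union ?_ (isCompact_range D.j₂_cont).isClosed
  exact (hV'.isClosed_compl.isCompact.image D.j₁_cont).isClosed

/-- The same gluing with the two balls interchanged. -/
def SphereSplit.swap {d : ℕ} {S : Type u} [TopologicalSpace S] {A A' : Ball.{u} d}
    (s : SphereSplit d S A A') : SphereSplit d S A' A :=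
  ⟨s.r, s.l, s.r_cont, s.l_cont, s.r_inj, s.l_inj, by rw [Set.union_comm]; exact s.cover,
    by rw [Set.inter_comm]; exact s.inter', by rw [Set.inter_comm]; exact s.inter⟩

/-- The same gluing with the two balls interchanged. -/
def BallGluing.swap {k : ℕ} {B₁ B₂ B : Ball.{u} k} (D : BallGluing B₁ B₂ B) :
    BallGluing B₂ B₁ B :=
  ⟨D.j₂, D.j₁, D.j₂_cont, D.j₁_cont, D.j₂_inj, D.j₁_inj,
    by rw [Set.union_comm]; exact D.cover, D.Y, D.Z₂, D.Z₁, D.s₂, D.s₁, D.s.swap,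
    fun x₁ x₂ => by
      rw [eq_comm, D.meet x₂ x₁]
      exact exists_congr fun _ => and_comm, D.bd₂, D.bd₁⟩

theorem BStep.piece {k : ℕ} {F G : Fam.{u} k} {g : F.Tot → G.Tot} (hg : BStep F G g) (a : F.ι) :
    ∃ (b : G.ι) (j : F.X a → G.X b), Continuous j ∧ (∀ x, g ⟨a, x⟩ = ⟨b, j x⟩) ∧
      ∀ x, x ∉ bd k (F.X a) → j x ∉ bd k (G.X b) := by
  obtain ⟨x₀⟩ : Nonempty (F.X a) := inferInstance
  rcases hg (g ⟨a, x₀⟩).1 with ⟨a', h, hh, hu⟩ | ⟨a₁, a₂, D, -, h1, h2, hu⟩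
  · obtain rfl : a = a' := hu ⟨a, x₀⟩ rfl
    exact ⟨_, h, h.continuous, hh, fun x hx hb => hx ((bd_homeo h x).2 hb)⟩
  · rcases hu ⟨a, x₀⟩ rfl with h | h
    · obtain rfl : a = a₁ := h
      exact ⟨_, D.j₁, D.j₁_cont, h1, fun x hx => D.not_bd₁ hx⟩
    · obtain rfl : a = a₂ := h
      exact ⟨_, D.j₂, D.j₂_cont, h2, fun x hx => D.swap.not_bd₁ hx⟩

/-- Maps between families of balls which are continuous and preserve interiors. -/
def IntMap {k : ℕ} {F G : Fam.{u} k} (g : F.Tot → G.Tot) : Prop :=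
  Continuous g ∧ ∀ z : F.Tot, z.2 ∉ bd k (F.X z.1) → (g z).2 ∉ bd k (G.X (g z).1)

theorem IntMap.id {k : ℕ} {F : Fam.{u} k} : IntMap (id : F.Tot → F.Tot) :=
  ⟨continuous_id, fun _ h => h⟩

theorem IntMap.comp {k : ℕ} {F G H : Fam.{u} k} {g : F.Tot → G.Tot} {g' : G.Tot → H.Tot}
    (hg' : IntMap g') (hg : IntMap g) : IntMap (g' ∘ g) :=
  ⟨hg'.1.comp hg.1, fun z h => hg'.2 _ (hg.2 z h)⟩

theorem BStep.intMap {k : ℕ} {F G : Fam.{u} k} {g : F.Tot → G.Tot} (hg : BStep F G g) :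
    IntMap g := by
  constructor
  · refine continuous_sigma fun a => ?_
    obtain ⟨b, j, hj, hgj, -⟩ := hg.piece a
    have : (fun x => g ⟨a, x⟩) = fun x => (⟨b, j x⟩ : G.Tot) := funext hgj
    rw [this]
    exact continuous_sigmaMk.comp hj
  · rintro ⟨a, x⟩ hx
    obtain ⟨b, j, -, hgj, hi⟩ := hg.piece a
    rw [hgj x]
    exact hi x hx

theorem Tot_not_bd {k : ℕ} {F : Fam.{u} k} (z : F.Tot) (hz : z.2 ∉ bd k (F.X z.1)) :
    z ∉ bd k F.Tot := by
  obtain ⟨a, x⟩ := z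
  obtain ⟨U, hU, hxU, hk⟩ := not_not.1 hz
  exact not_bd_of_isOpenEmbedding (N := F.Tot) (q := fun x : F.X a => ⟨a, x⟩) (U := U)
    (IsOpenEmbedding.sigmaMk.comp hU.isOpenEmbedding_subtypeVal) hk hxU

theorem IntMap.unique {k : ℕ} {F G : Fam.{u} k} {W : Type u} [TopologicalSpace W]
    {q : G.Tot → W} (hq : GluesUp k q) {g g' : F.Tot → G.Tot} (hg : IntMap g) (hg' : IntMap g')
    (h : q ∘ g = q ∘ g') : g = g' := by
  have hd : Dense {z : F.Tot | z.2 ∉ bd k (F.X z.1)} := by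
    rintro ⟨a, x⟩
    have := ball_int_dense (F.X a) x
    have h2 := image_closure_subset_closure_image
      (continuous_sigmaMk (σ := fun i => F.X i) (i := a)) ⟨x, this, rfl⟩
    refine closure_mono ?_ h2
    rintro _ ⟨w, hw, rfl⟩
    exact hw
  refine Continuous.ext_on hd hg.1 hg'.1 fun z hz => ?_
  exact hq.inj (Tot_not_bd _ (hg.2 z hz)) (congrFun h z)

/-! ## The functor on decompositions -/

namespace RawCat

variable {C : RawCat.{u, v}}

theorem LStep.bStep {k : ℕ} {F G : Fam.{u} k} {e : C.Lab F} {e' : C.Lab G} {g : F.Tot → G.Tot}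
    (h : C.LStep e e' g) : BStep F G g := by
  intro b
  rcases h b with ⟨a, f, h1, h2, -⟩ | ⟨a₁, a₂, D, h1, h2, h3, h4, -⟩
  · exact Or.inl ⟨a, f, h1, h2⟩
  · exact Or.inr ⟨a₁, a₂, D, h1, h2, h3, h4⟩

theorem LSeq.intMap {k : ℕ} {F G : Fam.{u} k} {e : C.Lab F} {e' : C.Lab G} {g : F.Tot → G.Tot}
    (h : C.LSeq e e' g) : IntMap g := by
  induction h with
  | refl e => exact IntMap.id
  | tail _ hs ih => exact hs.bStep.intMap.comp ih

theorem LSeq.trans {k : ℕ} {F G H : Fam.{u} k} {e : C.Lab F} {e' : C.Lab G} {e'' : C.Lab H}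
    {g : F.Tot → G.Tot} {g' : G.Tot → H.Tot} (h : C.LSeq e e' g) (h' : C.LSeq e' e'' g') :
    C.LSeq e e'' (g' ∘ g) := by
  induction h' with
  | refl _ => exact h
  | @tail _ _ _ _ _ _ _ _ hs ih => exact LSeq.tail (g := _ ∘ g) (ih h) hs

theorem reps_injective {k : ℕ} {N : Type u} [TopologicalSpace N] {β β' : C.UC k N}
    (h : reps β = reps β') : β = β' := by
  induction β using Quot.ind with
  | mk L =>
    have h1 : L.1 ∈ reps (Quot.mk _ L : C.UC k N) := ⟨L.2, rfl⟩
    rw [h] at h1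
    exact h1.2

/-- A labelling of a permissible decomposition, as a labelled decomposition. -/
abbrev toLD {k : ℕ} {W : Type u} [TopologicalSpace W] (x : Dec k W) (e : C.Lab x.F) : C.LD k W :=
  ⟨x.F, x.p, e⟩

/-- The labellings of a permissible decomposition whose restrictions to shared boundaries agree
and whose restriction to `∂W` is `c`. -/
def Adm {k : ℕ} {W : Type u} [TopologicalSpace W] (c : C.UC (k - 1) (bd k W)) (x : Dec k W)
    (e : C.Lab x.F) : Prop :=
  Compat (toLD x e) (reps c)

/-- The labelling `e'` of `y` is obtained by gluing together the labels `e` on `x`. -/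
def GluedTo {k : ℕ} {W : Type u} [TopologicalSpace W] {x y : Dec k W} (e : C.Lab x.F)
    (e' : C.Lab y.F) : Prop :=
  ∃ g, C.LSeq e e' g ∧ y.p ∘ g = x.p

theorem GluedTo.trans {k : ℕ} {W : Type u} [TopologicalSpace W] {x y z : Dec k W}
    {e : C.Lab x.F} {e' : C.Lab y.F} {e'' : C.Lab z.F} (h : GluedTo e e') (h' : GluedTo e' e'') :
    GluedTo e e'' := by
  obtain ⟨g, hg, hp⟩ := h
  obtain ⟨g', hg', hp'⟩ := h'
  exact ⟨g' ∘ g, hg.trans hg', by rw [← Function.comp_assoc, hp', hp]⟩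

theorem exists_gluedTo {k : ℕ} {W : Type u} [TopologicalSpace W] {c : C.UC (k - 1) (bd k W)}
    {x y : Dec k W} (h : x ≤ y) {e : C.Lab x.F} (he : Adm c x e) :
    ∃ e' : C.Lab y.F, GluedTo e e' ∧ Adm c y e' := by
  induction (show Relation.ReflTransGen Dec.Step x y from h) with
  | refl => exact ⟨e, ⟨id, LSeq.refl e, rfl⟩, he⟩
  | @tail y z hxy hyz ih =>
    obtain ⟨e', ⟨g, hg, hp⟩, he'⟩ := ih hxy
    obtain ⟨g', hg', hp'⟩ := hyz
    obtain ⟨e'', hs⟩ := (he'.2 _ Relation.ReflTransGen.refl).2 z.F z.p g' z.perm hp' hg'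
    refine ⟨e'', ⟨g' ∘ g, hg.tail hs, by rw [← Function.comp_assoc, hp', hp]⟩, z.perm, ?_⟩
    intro L' hL'
    exact he'.2 L' (Relation.ReflTransGen.head ⟨g', hs, hp', z.perm⟩ hL')

/-- Labellings with the same boundary values. -/
def SameBd {k : ℕ} {F : Fam.{u} k} (e d : C.Lab F) : Prop :=
  ∀ i, {L | C.bdry (e i) L} = {L | C.bdry (d i) L}

end RawCat

namespace NCat

variable {R : Type w} [CommRing R] {n : ℕ} (C : NCat.{u, v, w} R n)

theorem bdry_eq_of {k : ℕ} (hk : k ≤ n) {X : Ball.{u} k} {c c' : C.Mor k X}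
    {L : LDec C.Mor (k - 1) (bd k X)} (h : C.bdry c L) (h' : C.bdry c' L) :
    {L | C.bdry c L} = {L | C.bdry c' L} := by
  obtain ⟨β, hβ⟩ := C.bdry_class hk c
  obtain ⟨β', hβ'⟩ := C.bdry_class hk c'
  rw [hβ, hβ']
  have h1 : L ∈ reps β := hβ ▸ h
  have h2 : L ∈ reps β' := hβ' ▸ h'
  rw [← h1.2, ← h2.2]

theorem act_sameBd {k : ℕ} (hk : k ≤ n) {X X' : Ball.{u} k} (f : X ≃ₜ X') {c d : C.Mor k X}
    (h : {L | C.bdry c L} = {L | C.bdry d L}) :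
    {L | C.bdry (C.act f c) L} = {L | C.bdry (C.act f d) L} := by
  obtain ⟨β, hβ⟩ := C.bdry_class hk c
  obtain ⟨L, hL⟩ : ∃ L, C.bdry c L := by
    induction β using Quot.ind with
    | mk L => exact ⟨L.1, hβ.symm.subset ⟨L.2, rfl⟩⟩
  exact C.bdry_eq_of hk (C.bdry_nat hk f c L hL) (C.bdry_nat hk f d L (h.subset hL))

theorem glue_sameBd {k : ℕ} (hk : k ≤ n) {B₁ B₂ B : Ball.{u} k} (D : BallGluing B₁ B₂ B)
    {c₁ d₁ : C.Mor k B₁} {c₂ d₂ : C.Mor k B₂} {c : C.Mor k B} (h : C.glue D c₁ c₂ c)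
    (h₁ : {L | C.bdry c₁ L} = {L | C.bdry d₁ L}) (h₂ : {L | C.bdry c₂ L} = {L | C.bdry d₂ L}) :
    ∃ d, C.glue D d₁ d₂ d ∧ {L | C.bdry c L} = {L | C.bdry d L} := by
  obtain ⟨a, b₁, b₂, hb₁, hb₂⟩ := (C.glue_iff hk D c₁ c₂).1 ⟨c, h⟩
  obtain ⟨d, hd⟩ := (C.glue_iff hk D d₁ d₂).2 ⟨a, b₁, b₂, h₁.subset hb₁, h₂.subset hb₂⟩
  exact ⟨d, hd, C.bdry_eq_of hk (C.glue_bdry hk D _ _ _ _ _ _ h hb₁ hb₂)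
    (C.glue_bdry hk D _ _ _ _ _ _ hd (h₁.subset hb₁) (h₂.subset hb₂))⟩

theorem step_sameBd {k : ℕ} (hk : k ≤ n) {F G : Fam.{u} k} {e d : C.Lab F} {e' : C.Lab G}
    {g : F.Tot → G.Tot} (h : C.LStep e e' g) (hed : SameBd e d) :
    ∃ d' : C.Lab G, C.LStep d d' g ∧ SameBd e' d' := by
  have : ∀ b, ∃ m, C.LPiece d g b m ∧ {L | C.bdry (e' b) L} = {L | C.bdry m L} := by
    intro b
    rcases h b with ⟨a, f, h1, h2, h3⟩ | ⟨a₁, a₂, D, h1, h2, h3, h4, h5⟩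
    · exact ⟨_, Or.inl ⟨a, f, h1, h2, rfl⟩, h3 ▸ C.act_sameBd hk f (hed a)⟩
    · obtain ⟨m, hm, hm'⟩ := C.glue_sameBd hk D h5 (hed a₁) (hed a₂)
      exact ⟨m, Or.inr ⟨a₁, a₂, D, h1, h2, h3, h4, hm⟩, hm'⟩
  choose d' h1 h2 using this
  exact ⟨d', h1, h2⟩

theorem agree_sameBd {k : ℕ} {M : Type u} [TopologicalSpace M] {F : Fam.{u} k} {p : F.Tot → M}
    {e d : C.Lab F} (hed : SameBd e d) {Lc : C.LD (k - 1) (bd k M)}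
    (h : Agree (C := C.toRawCat) ⟨F, p, e⟩ Lc) : Agree (C := C.toRawCat) ⟨F, p, d⟩ Lc := by
  obtain ⟨K, hK, hc⟩ := h
  exact ⟨K, fun i => (hed i).subset (hK i), hc⟩

theorem compat_sameBd {k : ℕ} (hk : k ≤ n) {M : Type u} [TopologicalSpace M] {F : Fam.{u} k}
    {p : F.Tot → M} {e d : C.Lab F} (hed : SameBd e d) {S : Set (C.LD (k - 1) (bd k M))}
    (h : Compat (C := C.toRawCat) ⟨F, p, e⟩ S) : Compat (C := C.toRawCat) ⟨F, p, d⟩ S := by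
  refine ⟨h.1, fun L' hL' => ?_⟩
  have key : ∃ e' : C.Lab L'.F, SameBd e' L'.e ∧
      Relation.ReflTransGen StepTo (⟨F, p, e⟩ : C.LD k M) ⟨L'.F, L'.p, e'⟩ := by
    induction hL' with
    | refl => exact ⟨e, hed, Relation.ReflTransGen.refl⟩
    | @tail L₁ L₂ _ hs ih =>
      obtain ⟨e₁, hs₁, hr⟩ := ih
      obtain ⟨g, hg, hp, hperm⟩ := hs
      obtain ⟨e₂, h1, h2⟩ := C.step_sameBd hk hg (fun i => (hs₁ i).symm)
      exact ⟨e₂, fun i => (h2 i).symm, hr.tail ⟨g, h1, hp, hperm⟩⟩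
  obtain ⟨e', hs, hr⟩ := key
  obtain ⟨⟨Lc, hLc, ha⟩, hl⟩ := h.2 _ hr
  refine ⟨⟨Lc, hLc, C.agree_sameBd hs ha⟩, fun G q g hq hqg hb => ?_⟩
  obtain ⟨m, hm⟩ := hl G q g hq hqg hb
  obtain ⟨m', hm', -⟩ := C.step_sameBd hk hm hs
  exact ⟨m', hm'⟩

/-- Three labellings which agree except for one label, and there the third one is a linear
combination of the other two. -/
def LinAt {F : Fam.{u} n} (r s : R) (i : F.ι) (e₁ e₂ e₃ : C.Lab F) : Prop :=
  (∀ a, a ≠ i → e₂ a = e₁ a ∧ e₃ a = e₁ a) ∧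
  ∃ (β : C.UC (n - 1) (bd n (F.X i))) (c d : C.Fib (F.X i) β),
    e₁ i = c.1 ∧ e₂ i = d.1 ∧ e₃ i = (r • c + s • d).1

theorem LinAt.sameBd {F : Fam.{u} n} {r s : R} {i : F.ι} {e₁ e₂ e₃ : C.Lab F}
    (h : C.LinAt r s i e₁ e₂ e₃) : SameBd e₁ e₂ ∧ SameBd e₁ e₃ := by
  obtain ⟨h1, β, c, d, hc, hd, hcd⟩ := h
  constructor <;> intro a <;> by_cases ha : a = i
  · subst ha; rw [hc, hd, c.2, d.2]
  · rw [(h1 a ha).1]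
  · subst ha; rw [hc, hcd, c.2, (r • c + s • d).2]
  · rw [(h1 a ha).2]

theorem step_linAt {F G : Fam.{u} n} {r s : R} {i : F.ι} {e₁ e₂ e₃ : C.Lab F}
    (h : C.LinAt r s i e₁ e₂ e₃) {e₁' : C.Lab G} {g : F.Tot → G.Tot} (hg : C.LStep e₁ e₁' g) :
    ∃ (e₂' e₃' : C.Lab G) (b : G.ι), C.LStep e₂ e₂' g ∧ C.LStep e₃ e₃' g ∧
      C.LinAt r s b e₁' e₂' e₃' := by
  obtain ⟨hs₂, hs₃⟩ := h.sameBd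
  obtain ⟨h1, β, c, d, hc, hd, hcd⟩ := h
  obtain ⟨x₀⟩ : Nonempty (F.X i) := inferInstance
  obtain ⟨b₀, hb₀⟩ : ∃ b, b = (g ⟨i, x₀⟩).1 := ⟨_, rfl⟩
  have main : ∀ b, ∃ m₂ m₃, C.LPiece e₂ g b m₂ ∧ C.LPiece e₃ g b m₃ ∧
      (b ≠ b₀ → m₂ = e₁' b ∧ m₃ = e₁' b) ∧
      (b = b₀ → ∃ (β : C.UC (n - 1) (bd n (G.X b))) (c d : C.Fib (G.X b) β),
        e₁' b = c.1 ∧ m₂ = d.1 ∧ m₃ = (r • c + s • d).1) := by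
    intro b
    obtain ⟨β', hβ'⟩ := C.bdry_class le_rfl (e₁' b)
    have hne : ∀ a, (∀ x, (g ⟨a, x⟩).1 = b) → b ≠ b₀ → a ≠ i := by
      rintro a ha hb rfl
      exact hb ((ha x₀).symm.trans hb₀.symm)
    rcases hg b with ⟨a, f, k1, k2, k3⟩ | ⟨a₁, a₂, D, k1, k2, k3, k4, k5⟩
    · by_cases hb : b = b₀
      · obtain rfl : i = a := k2 ⟨i, x₀⟩ (hb₀.symm.trans hb.symm)
        refine ⟨C.act f (e₂ i), C.act f (e₃ i), Or.inl ⟨i, f, k1, k2, rfl⟩,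
          Or.inl ⟨i, f, k1, k2, rfl⟩, fun h => absurd hb h, fun _ => ?_⟩
        refine ⟨β', ⟨e₁' b, hβ'⟩, ⟨C.act f (e₂ i), ?_⟩, rfl, rfl, ?_⟩
        · rw [← hβ', ← k3]
          exact (C.act_sameBd le_rfl f (hs₂ i)).symm
        · rw [hcd]
          exact C.act_lin f r s c d _ _ (by rw [← hc]; exact k3) (by rw [← hd])
      · have hai := hne a (fun x => by rw [k1]) hb
        refine ⟨e₁' b, e₁' b, Or.inl ⟨a, f, k1, k2, ?_⟩, Or.inl ⟨a, f, k1, k2, ?_⟩,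
          fun _ => ⟨rfl, rfl⟩, fun h => absurd h hb⟩
        · rw [(h1 a hai).1, k3]
        · rw [(h1 a hai).2, k3]
    · by_cases hb : b = b₀
      · rcases k4 ⟨i, x₀⟩ (hb₀.symm.trans hb.symm) with h' | h'
        · obtain rfl : i = a₁ := h'
          have h2 := h1 a₂ (Ne.symm k1)
          obtain ⟨m, hm, hm'⟩ := C.glue_sameBd le_rfl D k5 (hs₂ i) (hs₂ a₂)
          have h3 := C.glue_lin_left D r s c d (e₁ a₂) ⟨e₁' b, hβ'⟩ ⟨m, hm' ▸ hβ'⟩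
            (by rw [← hc]; exact k5) (by rw [← hd, ← h2.1]; exact hm)
          rw [← hcd, ← h2.2] at h3
          exact ⟨m, _, Or.inr ⟨i, a₂, D, k1, k2, k3, k4, hm⟩,
            Or.inr ⟨i, a₂, D, k1, k2, k3, k4, h3⟩, fun h => absurd hb h,
            fun _ => ⟨β', _, _, rfl, rfl, rfl⟩⟩
        · obtain rfl : i = a₂ := h'
          have h2 := h1 a₁ k1
          obtain ⟨m, hm, hm'⟩ := C.glue_sameBd le_rfl D k5 (hs₂ a₁) (hs₂ i)
          have h3 := C.glue_lin_right D r s (e₁ a₁) c d ⟨e₁' b, hβ'⟩ ⟨m, hm' ▸ hβ'⟩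
            (by rw [← hc]; exact k5) (by rw [← hd, ← h2.1]; exact hm)
          rw [← hcd, ← h2.2] at h3
          exact ⟨m, _, Or.inr ⟨a₁, i, D, k1, k2, k3, k4, hm⟩,
            Or.inr ⟨a₁, i, D, k1, k2, k3, k4, h3⟩, fun h => absurd hb h,
            fun _ => ⟨β', _, _, rfl, rfl, rfl⟩⟩
      · have ha₁ := h1 a₁ (hne a₁ (fun x => by rw [k2]) hb)
        have ha₂ := h1 a₂ (hne a₂ (fun x => by rw [k3]) hb)
        refine ⟨e₁' b, e₁' b, Or.inr ⟨a₁, a₂, D, k1, k2, k3, k4, ?_⟩,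
          Or.inr ⟨a₁, a₂, D, k1, k2, k3, k4, ?_⟩, fun _ => ⟨rfl, rfl⟩, fun h => absurd h hb⟩
        · rw [ha₁.1, ha₂.1]; exact k5
        · rw [ha₁.2, ha₂.2]; exact k5
  choose e₂' e₃' k1 k2 k3 k4 using main
  exact ⟨e₂', e₃', b₀, k1, k2, fun b hb => k3 b hb, k4 b₀ rfl⟩

theorem seq_linAt {F G : Fam.{u} n} {e₁ : C.Lab F} {e₁' : C.Lab G} {g : F.Tot → G.Tot}
    (hg : C.LSeq e₁ e₁' g) {r s : R} {i : F.ι} {e₂ e₃ : C.Lab F} (h : C.LinAt r s i e₁ e₂ e₃) :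
    ∃ (e₂' e₃' : C.Lab G) (b : G.ι), C.LSeq e₂ e₂' g ∧ C.LSeq e₃ e₃' g ∧
      C.LinAt r s b e₁' e₂' e₃' := by
  induction hg with
  | refl e => exact ⟨e₂, e₃, i, LSeq.refl _, LSeq.refl _, h⟩
  | tail _ hs ih =>
    obtain ⟨f₂, f₃, j, h2, h3, hl⟩ := ih h
    obtain ⟨f₂', f₃', b, k2, k3, hl'⟩ := C.step_linAt hl hs
    exact ⟨f₂', f₃', b, h2.tail k2, h3.tail k3, hl'⟩

variable {W : Type u} [TopologicalSpace W] {C}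

theorem gluedTo_unique {x y : Dec n W} {e : C.Lab x.F} {e' e'' : C.Lab y.F}
    (h : GluedTo (C := C.toRawCat) e e') (h' : GluedTo (C := C.toRawCat) e e'') : e' = e'' := by
  obtain ⟨g, hg, hp⟩ := h
  obtain ⟨g', hg', hp'⟩ := h'
  obtain rfl : g = g' := IntMap.unique y.perm hg.intMap hg'.intMap (hp.trans hp'.symm)
  exact C.assoc le_rfl _ _ _ _ hg hg'

/-- The result of gluing together an admissible labelling along a refinement. -/
def glued {c : C.UC (n - 1) (bd n W)} {x y : Dec n W} (h : x ≤ y) {e : C.Lab x.F}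
    (he : Adm c x e) : C.Lab y.F :=
  (exists_gluedTo h he).choose

theorem glued_spec {c : C.UC (n - 1) (bd n W)} {x y : Dec n W} (h : x ≤ y) {e : C.Lab x.F}
    (he : Adm c x e) : GluedTo e (glued h he) ∧ Adm c y (glued h he) :=
  (exists_gluedTo h he).choose_spec

/-- The boundary conditions `β` on the balls of a decomposition `x` of `W` which are compatible
with each other and restrict to `c` on `∂W`; compatibility of labels only depends on
their boundaries. -/
abbrev BdIx (c : C.UC (n - 1) (bd n W)) (x : Dec n W) : Type (max (u + 1) v) :=
  {β : ∀ i, C.UC (n - 1) (bd n (x.F.X i)) //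
    ∃ e : C.Lab x.F, (∀ i, {L | C.bdry (e i) L} = reps (β i)) ∧ Adm c x e}

theorem BdIx.adm {c : C.UC (n - 1) (bd n W)} {x : Dec n W} (β : BdIx c x) {e : C.Lab x.F}
    (he : ∀ i, {L | C.bdry (e i) L} = reps (β.1 i)) : Adm c x e := by
  obtain ⟨d, hd, hA⟩ := β.2
  exact C.compat_sameBd le_rfl (fun i => (hd i).trans (he i).symm) hA

/-- `ψ(x; c) = ⨁_β ⨂_a C(X_a; β_a)`, the sum being over all compatible boundary conditions. -/
abbrev Psi (c : C.UC (n - 1) (bd n W)) (x : Dec n W) : Type (max (u + 1) v w) :=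
  DirectSum (BdIx c x) fun β => PiTensorProduct R fun i => C.Fib (x.F.X i) (β.1 i)

open Classical in
/-- The element of `ψ(x; c)` given by a compatible labelling. -/
def gen {c : C.UC (n - 1) (bd n W)} {x : Dec n W} {e : C.Lab x.F} (he : Adm c x e) :
    Psi c x :=
  DirectSum.lof R (BdIx c x) (fun β => PiTensorProduct R fun i => C.Fib (x.F.X i) (β.1 i))
    ⟨fun i => (C.bdry_class le_rfl (e i)).choose,
      e, fun i => (C.bdry_class le_rfl (e i)).choose_spec, he⟩
    (PiTensorProduct.tprod R fun i => ⟨e i, (C.bdry_class le_rfl (e i)).choose_spec⟩)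

open Classical in
theorem gen_eq {c : C.UC (n - 1) (bd n W)} {x : Dec n W} (β : BdIx c x)
    (f : ∀ i, C.Fib (x.F.X i) (β.1 i)) (he : Adm c x fun i => (f i).1) :
    gen he = DirectSum.lof R (BdIx c x)
      (fun β => PiTensorProduct R fun i => C.Fib (x.F.X i) (β.1 i)) β
      (PiTensorProduct.tprod R f) := by
  have key : ∀ (γ : ∀ i, C.UC (n - 1) (bd n (x.F.X i))) (hγ : γ = β.1)
      (h : ∀ i, {L | C.bdry (f i).1 L} = reps (γ i)),
      DirectSum.lof R (BdIx c x) (fun β => PiTensorProduct R fun i => C.Fib (x.F.X i) (β.1 i))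
        ⟨γ, fun i => (f i).1, h, he⟩ (PiTensorProduct.tprod R fun i => ⟨(f i).1, h i⟩) =
      DirectSum.lof R (BdIx c x) (fun β => PiTensorProduct R fun i => C.Fib (x.F.X i) (β.1 i)) β
        (PiTensorProduct.tprod R f) := by
    obtain ⟨β, hβ⟩ := β
    rintro γ rfl h
    rfl
  exact key _ (funext fun i => reps_injective
    ((C.bdry_class le_rfl (f i).1).choose_spec.symm.trans (f i).2)) _

open Classical in
theorem gen_eq' {c : C.UC (n - 1) (bd n W)} {x : Dec n W} (β : BdIx c x)
    (f : ∀ i, C.Fib (x.F.X i) (β.1 i)) {e : C.Lab x.F} (hf : e = fun i => (f i).1)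
    (he : Adm c x e) : gen he = DirectSum.lof R (BdIx c x)
      (fun β => PiTensorProduct R fun i => C.Fib (x.F.X i) (β.1 i)) β
      (PiTensorProduct.tprod R f) := by
  subst hf
  exact gen_eq β f he

open Classical in
theorem gen_linAt {c : C.UC (n - 1) (bd n W)} {x : Dec n W} {r s : R} {i : x.F.ι}
    {e₁ e₂ e₃ : C.Lab x.F} (h₁ : Adm c x e₁) (h₂ : Adm c x e₂) (h₃ : Adm c x e₃)
    (h : C.LinAt r s i e₁ e₂ e₃) : gen h₃ = r • gen h₁ + s • gen h₂ := by
  obtain ⟨hs₂, hs₃⟩ := h.sameBd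
  obtain ⟨h1, β₀, c', d', hc, hd, hcd⟩ := h
  let β : BdIx c x := ⟨fun i => (C.bdry_class le_rfl (e₁ i)).choose,
      e₁, fun i => (C.bdry_class le_rfl (e₁ i)).choose_spec, h₁⟩
  have hβ : ∀ i, {L | C.bdry (e₁ i) L} = reps (β.1 i) :=
    fun i => (C.bdry_class le_rfl (e₁ i)).choose_spec
  obtain rfl : β₀ = β.1 i := reps_injective (by rw [← hβ i, hc, c'.prop])
  let f₁ : ∀ i, C.Fib (x.F.X i) (β.1 i) := fun i => ⟨e₁ i, hβ i⟩
  have hf₁ : f₁ = Function.update f₁ i c' := by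
    funext a
    by_cases ha : a = i
    · subst ha; rw [Function.update_self]; exact Fib.ext hc
    · rw [Function.update_of_ne ha]
  have e1 : e₁ = fun a => (Function.update f₁ i c' a).1 := by rw [← hf₁]
  have e2 : e₂ = fun a => (Function.update f₁ i d' a).1 := by
    funext a
    by_cases ha : a = i
    · subst ha; rw [Function.update_self]; exact hd
    · rw [Function.update_of_ne ha]; exact (h1 a ha).1
  have e3 : e₃ = fun a => (Function.update f₁ i (r • c' + s • d') a).1 := by
    funext a
    by_cases ha : a = i
    · subst ha; rw [Function.update_self]; exact hcd
    · rw [Function.update_of_ne ha]; exact (h1 a ha).2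
  rw [gen_eq' β _ e1 h₁, gen_eq' β _ e2 h₂, gen_eq' β _ e3 h₃, MultilinearMap.map_update_add,
    MultilinearMap.map_update_smul, MultilinearMap.map_update_smul, map_add, map_smul, map_smul]

theorem glued_linAt {c : C.UC (n - 1) (bd n W)} {x y : Dec n W} (h : x ≤ y) {r s : R} {i : x.F.ι}
    {e₁ e₂ e₃ : C.Lab x.F} (h₁ : Adm c x e₁) (h₂ : Adm c x e₂) (h₃ : Adm c x e₃)
    (hl : C.LinAt r s i e₁ e₂ e₃) :
    ∃ b, C.LinAt r s b (glued h h₁) (glued h h₂) (glued h h₃) := by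
  obtain ⟨g, hg, hp⟩ := (glued_spec h h₁).1
  obtain ⟨e₂', e₃', b, k2, k3, hl'⟩ := C.seq_linAt hg hl
  have q2 := gluedTo_unique ⟨g, k2, hp⟩ (glued_spec h h₂).1
  have q3 := gluedTo_unique ⟨g, k3, hp⟩ (glued_spec h h₃).1
  exact ⟨b, q2 ▸ q3 ▸ hl'⟩

theorem gen_glued_linAt {c : C.UC (n - 1) (bd n W)} {x y : Dec n W} (h : x ≤ y) {r s : R}
    {i : x.F.ι} {e₁ e₂ e₃ : C.Lab x.F} (h₁ : Adm c x e₁) (h₂ : Adm c x e₂) (h₃ : Adm c x e₃)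
    (hl : C.LinAt r s i e₁ e₂ e₃) :
    gen (glued_spec h h₃).2 = r • gen (glued_spec h h₁).2 + s • gen (glued_spec h h₂).2 := by
  obtain ⟨b, hb⟩ := glued_linAt h h₁ h₂ h₃ hl
  exact gen_linAt _ _ _ hb

theorem linAt_update {F : Fam.{u} n} [DecidableEq F.ι] {β : ∀ i, C.UC (n - 1) (bd n (F.X i))}
    (f : ∀ i, C.Fib (F.X i) (β i)) (i : F.ι) (r s : R) (c d : C.Fib (F.X i) (β i)) :
    C.LinAt r s i (fun a => (Function.update f i c a).1) (fun a => (Function.update f i d a).1)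
      (fun a => (Function.update f i (r • c + s • d) a).1) := by
  refine ⟨fun a ha => ?_, β i, c, d, ?_, ?_, ?_⟩
  · simp [Function.update_of_ne ha]
  all_goals simp

/-- Gluing, as a multilinear map on the labels with given boundary conditions. -/
def gluedMul {c : C.UC (n - 1) (bd n W)} {x y : Dec n W} (h : x ≤ y) (β : BdIx c x) :
    MultilinearMap R (fun i => C.Fib (x.F.X i) (β.1 i)) (Psi c y) where
  toFun f := gen (glued_spec h (β.adm fun i => (f i).2)).2
  map_update_add' f i v v' := by
    have hl := linAt_update f i (1 : R) 1 v v'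
    simp only [one_smul] at hl
    have := gen_glued_linAt h (β.adm fun j => (Function.update f i v j).2)
      (β.adm fun j => (Function.update f i v' j).2)
      (β.adm fun j => (Function.update f i (v + v') j).2) hl
    rwa [one_smul, one_smul] at this
  map_update_smul' f i r v := by
    have hl := linAt_update f i r 0 v v
    simp only [zero_smul, add_zero] at hl
    have := gen_glued_linAt h (β.adm fun j => (Function.update f i v j).2)
      (β.adm fun j => (Function.update f i v j).2)
      (β.adm fun j => (Function.update f i (r • v) j).2) hl
    rwa [zero_smul, add_zero] at this

open Classical in
/-- The map `ψ(x; c) → ψ(y; c)` given by the composition maps, for a refinement `x` of `y`. -/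
def psiMap {c : C.UC (n - 1) (bd n W)} {x y : Dec n W} (h : x ≤ y) : Psi c x →ₗ[R] Psi c y :=
  DirectSum.toModule R (BdIx c x) (Psi c y) fun β => PiTensorProduct.lift (gluedMul h β)

theorem psiMap_gen {c : C.UC (n - 1) (bd n W)} {x y : Dec n W} (h : x ≤ y) {e : C.Lab x.F}
    (he : Adm c x e) {e' : C.Lab y.F} (hg : GluedTo e e') (he' : Adm c y e') :
    psiMap h (gen he) = gen he' := by
  obtain rfl : glued h he = e' := gluedTo_unique (glued_spec h he).1 hg
  rw [psiMap, gen, DirectSum.toModule_lof, PiTensorProduct.lift.tprod]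
  rfl

theorem psi_ext {c : C.UC (n - 1) (bd n W)} {x : Dec n W} {M : Type*} [AddCommGroup M] [Module R M]
    {f f' : Psi c x →ₗ[R] M} (h : ∀ (e : C.Lab x.F) (he : Adm c x e), f (gen he) = f' (gen he)) :
    f = f' := by
  classical
  refine DirectSum.linearMap_ext R fun β => PiTensorProduct.ext (MultilinearMap.ext fun v => ?_)
  have := h _ (β.adm fun i => (v i).2)
  rw [gen_eq β v] at this
  exact this

variable (C)

/-- The functor `ψ` from the poset of permissible decompositions of `W` to `R`-modules, for the
boundary condition `c` on `∂W`. -/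
def psi (c : C.UC (n - 1) (bd n W)) : Dec n W ⥤ ModuleCat.{max (u + 1) v w} R where
  obj x := ModuleCat.of R (Psi c x)
  map h := ModuleCat.ofHom (psiMap (leOfHom h))
  map_id x := by
    refine ModuleCat.hom_ext (psi_ext fun e he => ?_)
    exact psiMap_gen le_rfl he ⟨id, LSeq.refl e, rfl⟩ he
  map_comp {x y z} h h' := by
    refine ModuleCat.hom_ext (psi_ext fun e he => ?_)
    have h1 := glued_spec (leOfHom h) he
    have h2 := glued_spec (leOfHom h') h1.2
    have k1 := psiMap_gen (leOfHom h) he h1.1 h1.2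
    have k2 := psiMap_gen (leOfHom h') h1.2 h2.1 h2.2
    have k3 := psiMap_gen (leOfHom (h ≫ h')) he (h1.1.trans h2.1) h2.2
    simp only [ModuleCat.hom_comp, ModuleCat.hom_ofHom, LinearMap.comp_apply]
    rw [k1, k2, k3]

/-- The skein module of `W` with boundary condition `c`: the colimit of `C` along the permissible
decompositions of `W`. -/
def skeinModule (c : C.UC (n - 1) (bd n W)) : ModuleCat.{max (u + 1) v w} R :=
  Limits.colimit (C.psi c)

end NCat

/-! ## Homotopy colimits and the blob complex -/

section Hocolim

variable {R : Type w} [CommRing R] {D : Type u} [Preorder D] (Ψ : D ⥤ ModuleCat.{max u v w} R)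

theorem map_map {d d' d'' : D} (h : d ≤ d') (h' : d' ≤ d'') (a : Ψ.obj d) :
    (Ψ.map (homOfLE h')).hom ((Ψ.map (homOfLE h)).hom a) =
      (Ψ.map (homOfLE (h.trans h'))).hom a := by
  rw [← homOfLE_comp h h', Ψ.map_comp]
  rfl

open Classical in
theorem lof_congr {m : ℕ} (x y : Fin (m + 1) →o D) (hxy : x = y) {d : D} (h : d ≤ x 0)
    (h' : d ≤ y 0) (a : Ψ.obj d) :
    DirectSum.lof R (Fin (m + 1) →o D) (fun x => Ψ.obj (x 0)) x ((Ψ.map (homOfLE h)).hom a) =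
      DirectSum.lof R (Fin (m + 1) →o D) (fun x => Ψ.obj (x 0)) y
        ((Ψ.map (homOfLE h')).hom a) := by
  subst hxy
  rfl

/-- The sum of the modules `Ψ(x₀)` over the simplices `x = (x₀ ≤ ⋯ ≤ xₘ)` of `D`. -/
abbrev Simp (m : ℕ) : Type (max u v w) :=
  DirectSum (Fin (m + 1) →o D) fun x => Ψ.obj (x 0)

open Classical in
/-- The map sending the summand of `x` to that of `x ∘ θ` by `Ψ(x₀ ≤ x_{θ 0})`. -/
def simpMap {m m' : ℕ} (θ : Fin (m' + 1) →o Fin (m + 1)) :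
    Simp.{u, v, w} Ψ m →ₗ[R] Simp.{u, v, w} Ψ m' :=
  DirectSum.toModule R _ _ fun x =>
    (DirectSum.lof R (Fin (m' + 1) →o D) (fun x => Ψ.obj (x 0)) (x.comp θ)).comp
      (Ψ.map (homOfLE (x.monotone (Fin.zero_le (θ 0))))).hom

open Classical in
theorem simpMap_lof {m m' : ℕ} (θ : Fin (m' + 1) →o Fin (m + 1)) (x : Fin (m + 1) →o D)
    (a : Ψ.obj (x 0)) :
    simpMap.{u, v, w} Ψ θ (DirectSum.lof R (Fin (m + 1) →o D) (fun x => Ψ.obj (x 0)) x a) =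
      DirectSum.lof R (Fin (m' + 1) →o D) (fun x => Ψ.obj (x 0)) (x.comp θ)
        ((Ψ.map (homOfLE (x.monotone (Fin.zero_le (θ 0))))).hom a) := by
  rw [simpMap, DirectSum.toModule_lof]
  rfl

/-- The simplicial module of simplices of `Ψ`. -/
def simplices : SimplicialObject (ModuleCat.{max u v w} R) where
  obj Δ := ModuleCat.of R (Simp.{u, v, w} Ψ Δ.unop.len)
  map θ := ModuleCat.ofHom (simpMap.{u, v, w} Ψ θ.unop.toOrderHom)
  map_id Δ := by
    classical
    refine ModuleCat.hom_ext (DirectSum.linearMap_ext R fun x => LinearMap.ext fun a => ?_)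
    refine (simpMap_lof.{u, v, w} Ψ _ x a).trans ?_
    refine (lof_congr.{u, v, w} Ψ _ x rfl _ le_rfl a).trans ?_
    have : (Ψ.map (homOfLE (le_refl (x 0)))).hom a = a := by
      rw [show homOfLE (le_refl (x 0)) = 𝟙 (x 0) from rfl, Ψ.map_id]
      rfl
    rw [this]
    rfl
  map_comp θ θ' := by
    classical
    refine ModuleCat.hom_ext (DirectSum.linearMap_ext R fun x => LinearMap.ext fun a => ?_)
    refine (simpMap_lof.{u, v, w} Ψ _ x a).trans ?_
    refine Eq.trans ?_ (congrArg (simpMap.{u, v, w} Ψ θ'.unop.toOrderHom)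
      (simpMap_lof.{u, v, w} Ψ θ.unop.toOrderHom x a)).symm
    refine Eq.trans ?_ (simpMap_lof.{u, v, w} Ψ θ'.unop.toOrderHom
      (x.comp θ.unop.toOrderHom) _).symm
    refine Eq.trans ?_ (congrArg _ (map_map.{u, v, w} Ψ _ _ a).symm)
    exact lof_congr.{u, v, w} Ψ _ _ rfl _ _ a

/-- The explicit model of the homotopy colimit of `Ψ` in chain complexes: in degree `m` it is
`⨁ Ψ(x₀)` over the simplices `x₀ ≤ ⋯ ≤ xₘ`, with differential the alternating sum of the face
maps `(x, a) ↦ (d₀ x, Ψ(x₀ ≤ x₁) a)` and `(x, a) ↦ (dᵢ x, a)`, `0 < i ≤ m`. -/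
def hocolim : ChainComplex (ModuleCat.{max u v w} R) ℕ :=
  (AlgebraicTopology.alternatingFaceMapComplex _).obj (simplices.{u, v, w} Ψ)

open Classical in
/-- The canonical map to the colimit from the degree zero part `⨁_x Ψ(x)` of the homotopy
colimit. -/
def augmentation : (hocolim.{u, v, w} Ψ).X 0 ⟶ Limits.colimit Ψ :=
  ModuleCat.ofHom (DirectSum.toModule R (Fin 1 →o D) (Limits.colimit Ψ : ModuleCat _)
    fun x => (Limits.colimit.ι Ψ (x 0)).hom)

end Hocolim

/-- The blob complex of `W` with coefficients in `C` and boundary condition `c`. -/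
def NCat.blobComplex {R : Type w} [CommRing R] {n : ℕ} (C : NCat.{u, v, w} R n) {W : Type u}
    [TopologicalSpace W] (c : C.UC (n - 1) (bd n W)) :
    ChainComplex (ModuleCat.{max (u + 1) v w} R) ℕ :=
  hocolim.{u + 1, v, w} (C.psi c)

end DiskLike

end

open DiskLike

namespace DiskLike

universe u₁ v₁ w₁

section Hocolim

open CategoryTheory.Limits

variable {R : Type w₁} [CommRing R] {D : Type u₁} [Preorder D]
  (Ψ : D ⥤ ModuleCat.{max u₁ v₁ w₁} R)

/-! The argument is formal and works for any functor `Ψ` from a preorder to modules; the geometry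
enters only in making `ψ` such a functor. A chain complex supported in nonnegative degrees has as
zeroth homology the cokernel of its differential from degree one to degree zero. Here degree zero is
the direct sum of the modules `Ψ(x)`, and on a `1`-simplex the differential is `∂(x₀ ≤ x₁, a) = (x₁,
Ψ(x₀ ≤ x₁) a) - (x₀, a)`. Dividing by its image identifies every `a` with its image under each
transition map of `Ψ`, and this is the standard presentation of a colimit of modules. Degenerate
`1`-simplices `x ≤ x` are present too, but their boundary is zero, so they impose no relation.

The proof phrases this by universal properties. The formula for the differential is
`hocolim_d_one_zero`. By it, the augmentation to the colimit kills boundaries (`d_augmentation`),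
and conversely a map out of degree zero that kills boundaries is the same thing as a cocone under
`Ψ` (`coconeOfMap`), hence factors through the augmentation (`augmentation_desc`); the factorization
is unique because the augmentation is epi (`augmentation_ext`). So the augmentation is a cokernel of
the differential (`augmentationIsCokernel`), and uniqueness of cokernels gives an isomorphism from
the zeroth homology to the colimit under which the canonical projections from degree zero
correspond. -/

open Classical in
/-- The inclusion of the summand of `x` into the module of `m`-simplices. -/
noncomputable def simpIncl {m : ℕ} (x : Fin (m + 1) →o D) :
    Ψ.obj (x 0) →ₗ[R] Simp.{u₁, v₁, w₁} Ψ m :=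
  DirectSum.lof R (Fin (m + 1) →o D) (fun x => Ψ.obj (x 0)) x

theorem simp_ext {m : ℕ} {M : Type*} [AddCommGroup M] [Module R M]
    {f f' : Simp.{u₁, v₁, w₁} Ψ m →ₗ[R] M}
    (h : ∀ x a, f (simpIncl.{u₁, v₁, w₁} Ψ x a) = f' (simpIncl.{u₁, v₁, w₁} Ψ x a)) : f = f' := by
  classical
  exact DirectSum.linearMap_ext R fun x => LinearMap.ext fun a => h x a

/-! ### Vertices, edges, and the differential from degree one to degree zero. -/

/-- The `0`-simplex at an object. -/
def vertex (d : D) : Fin 1 →o D := ⟨fun _ => d, fun _ _ _ => le_rfl⟩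

/-- The `1`-simplex of a comparable pair of objects. -/
def edge {d d' : D} (h : d ≤ d') : Fin 2 →o D :=
  ⟨![d, d'], Fin.monotone_iff_le_succ.2 fun i => by
    obtain rfl : i = 0 := Subsingleton.elim _ _
    exact h⟩

theorem map_le_refl (d : D) (a : Ψ.obj d) : (Ψ.map (homOfLE (le_refl d))).hom a = a := by
  -- Morphisms in a preorder are proofs of inequalities, so the two agree by proof irrelevance.
  rw [show homOfLE (le_refl d) = 𝟙 d from rfl, Ψ.map_id]
  rfl

/-- A monotone map out of a one-point order is constant, but it is only propositionally, not
definitionally, the vertex at its value. The summands they index must therefore be identified by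
hand, although both carry the same module `Ψ(x₀)`. -/
theorem simpIncl_vertex_eq (x : Fin 1 →o D) (a : Ψ.obj (x 0)) :
    simpIncl.{u₁, v₁, w₁} Ψ (vertex (x 0)) a = simpIncl.{u₁, v₁, w₁} Ψ x a := by
  have hx : vertex (x 0) = x := by
    ext i
    exact congrArg x (Subsingleton.elim _ _)
  -- `lof_congr` moves elements of the form `Ψ(d ≤ x₀) a` between equal simplices. Taking `d = x₀`
  -- introduces the map `Ψ(x₀ ≤ x₀)` on both sides, and it is then removed as the identity.
  have := lof_congr.{u₁, v₁, w₁} Ψ (vertex (x 0)) x hx (d := x 0) le_rfl le_rfl a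
  exact (congrArg (simpIncl.{u₁, v₁, w₁} Ψ (vertex (x 0))) (map_le_refl.{u₁, v₁, w₁} Ψ (x 0) a)).symm.trans
    (this.trans (congrArg (simpIncl.{u₁, v₁, w₁} Ψ x) (map_le_refl.{u₁, v₁, w₁} Ψ (x 0) a)))

/-- Puts the faces of a `1`-simplex in normal form: a structure map down to degree zero yields the
composite `x.comp θ`, which is replaced by the vertex at `x (θ 0)`. -/
theorem simpMap_to_vertex {m : ℕ} (θ : Fin 1 →o Fin (m + 1)) (x : Fin (m + 1) →o D)
    (a : Ψ.obj (x 0)) :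
    simpMap.{u₁, v₁, w₁} Ψ θ (simpIncl.{u₁, v₁, w₁} Ψ x a) =
      simpIncl.{u₁, v₁, w₁} Ψ (vertex (x (θ 0)))
        ((Ψ.map (homOfLE (x.monotone (Fin.zero_le (θ 0))))).hom a) :=
  (simpMap_lof.{u₁, v₁, w₁} Ψ θ x a).trans (simpIncl_vertex_eq.{u₁, v₁, w₁} Ψ (x.comp θ) _).symm

/-- The face `δ₀` drops `x₀`, so the coefficient has to be carried to `x₁` by the transition map;
the face `δ₁` keeps `x₀` and leaves the coefficient alone. They enter the alternating sum with signs
`+` and `-`. -/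
theorem hocolim_d_one_zero (x : Fin 2 →o D) (a : Ψ.obj (x 0)) :
    ((hocolim.{u₁, v₁, w₁} Ψ).d 1 0).hom (simpIncl.{u₁, v₁, w₁} Ψ x a) =
      simpIncl.{u₁, v₁, w₁} Ψ (vertex (x 1))
        ((Ψ.map (homOfLE (x.monotone (Fin.zero_le 1)))).hom a) -
      simpIncl.{u₁, v₁, w₁} Ψ (vertex (x 0)) a := by
  have h0 := simpMap_to_vertex.{u₁, v₁, w₁} Ψ (SimplexCategory.δ (0 : Fin 2)).toOrderHom x a
  have h1 := simpMap_to_vertex.{u₁, v₁, w₁} Ψ (SimplexCategory.δ (1 : Fin 2)).toOrderHom x a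
  have hd : (hocolim.{u₁, v₁, w₁} Ψ).d 1 0 =
      (simplices.{u₁, v₁, w₁} Ψ).δ (0 : Fin 2) - (simplices.{u₁, v₁, w₁} Ψ).δ (1 : Fin 2) := by
    refine (AlgebraicTopology.AlternatingFaceMapComplex.obj_d_eq _ 0).trans ?_
    rw [Fin.sum_univ_two]
    simp [sub_eq_add_neg]
  rw [hd]
  -- The cofaces compute: `δ₀` sends `0` to `1` and `δ₁` sends `0` to `0`. What remains is that the
  -- second term carries a map `Ψ(x₀ ≤ x₀)`, which is the identity.
  refine congrArg₂ (· - ·) h0 (h1.trans ?_)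
  exact congrArg (simpIncl.{u₁, v₁, w₁} Ψ (vertex (x 0))) (map_le_refl.{u₁, v₁, w₁} Ψ (x 0) a)

/-! ### The augmentation as a cokernel. -/

theorem augmentation_simpIncl (x : Fin 1 →o D) (a : Ψ.obj (x 0)) :
    (augmentation.{u₁, v₁, w₁} Ψ).hom (simpIncl.{u₁, v₁, w₁} Ψ x a) =
      (colimit.ι Ψ (x 0)).hom a := by
  classical
  exact DirectSum.toModule_lof (M := fun x : Fin 1 →o D => Ψ.obj (x 0)) R x a

/-- On the edge `x₀ ≤ x₁` the composite is the difference between the leg at `x₁` after the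
transition map and the leg at `x₀`, which vanishes by the cocone relation of the colimit. -/
theorem d_augmentation :
    (hocolim.{u₁, v₁, w₁} Ψ).d 1 0 ≫ augmentation.{u₁, v₁, w₁} Ψ = 0 := by
  refine ModuleCat.hom_ext (simp_ext.{u₁, v₁, w₁} Ψ fun x a => ?_)
  have hw := congrArg (fun f => f.hom a)
    (colimit.w Ψ (homOfLE (x.monotone (Fin.zero_le (1 : Fin 2)))))
  refine (congrArg (augmentation.{u₁, v₁, w₁} Ψ).hom
    (hocolim_d_one_zero.{u₁, v₁, w₁} Ψ x a)).trans ?_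
  refine (map_sub (augmentation.{u₁, v₁, w₁} Ψ).hom _ _).trans ?_
  exact sub_eq_zero.2 (((augmentation_simpIncl.{u₁, v₁, w₁} Ψ _ _).trans hw).trans
    (augmentation_simpIncl.{u₁, v₁, w₁} Ψ _ _).symm)

/-- The augmentation is epi: every leg of the colimit cocone factors through it, via the summand of
a vertex, and the legs are jointly epi. -/
theorem augmentation_ext {Z : ModuleCat.{max u₁ v₁ w₁} R} {f f' : colimit Ψ ⟶ Z}
    (h : augmentation.{u₁, v₁, w₁} Ψ ≫ f = augmentation.{u₁, v₁, w₁} Ψ ≫ f') : f = f' := by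
  refine colimit.hom_ext fun d => ModuleCat.hom_ext (LinearMap.ext fun a => ?_)
  have := congrArg (fun g => g.hom (simpIncl.{u₁, v₁, w₁} Ψ (vertex d) a)) h
  exact ((congrArg f.hom (augmentation_simpIncl.{u₁, v₁, w₁} Ψ (vertex d) a)).symm.trans
    this).trans (congrArg f'.hom (augmentation_simpIncl.{u₁, v₁, w₁} Ψ (vertex d) a))

/-- The cocone under `Ψ` given by a map which vanishes on the boundaries of `1`-simplices. -/
noncomputable def coconeOfMap {Z : ModuleCat.{max u₁ v₁ w₁} R}
    (f : (hocolim.{u₁, v₁, w₁} Ψ).X 0 ⟶ Z) (hf : (hocolim.{u₁, v₁, w₁} Ψ).d 1 0 ≫ f = 0) :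
    Cocone Ψ where
  pt := Z
  ι :=
    { app := fun d => ModuleCat.ofHom (f.hom.comp (simpIncl.{u₁, v₁, w₁} Ψ (vertex d)))
      naturality := fun d d' h => by
        refine ModuleCat.hom_ext (LinearMap.ext fun a => ?_)
        -- Every morphism `d ⟶ d'` of the preorder is an edge, and naturality along it says exactly
        -- that `f` vanishes on the boundary of this edge with coefficient `a`.
        have h1 := congrArg (fun g => g.hom (simpIncl.{u₁, v₁, w₁} Ψ (edge (leOfHom h)) a)) hf
        have h2 := congrArg f.hom (hocolim_d_one_zero.{u₁, v₁, w₁} Ψ (edge (leOfHom h)) a)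
        exact sub_eq_zero.1 ((map_sub f.hom _ _).symm.trans (h2.symm.trans h1)) }

/-- Both sides are determined by their restrictions to the summands of degree zero, where the
augmentation is a leg of the colimit and the induced map returns the corresponding leg of the
cocone, that is, `f` on that summand. -/
theorem augmentation_desc {Z : ModuleCat.{max u₁ v₁ w₁} R}
    (f : (hocolim.{u₁, v₁, w₁} Ψ).X 0 ⟶ Z) (hf : (hocolim.{u₁, v₁, w₁} Ψ).d 1 0 ≫ f = 0) :
    augmentation.{u₁, v₁, w₁} Ψ ≫ colimit.desc Ψ (coconeOfMap.{u₁, v₁, w₁} Ψ f hf) = f := by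
  refine ModuleCat.hom_ext (simp_ext.{u₁, v₁, w₁} Ψ fun x a => ?_)
  have h := congrArg (fun g => g.hom a)
    (colimit.ι_desc (coconeOfMap.{u₁, v₁, w₁} Ψ f hf) (x 0))
  refine (congrArg (colimit.desc Ψ (coconeOfMap.{u₁, v₁, w₁} Ψ f hf)).hom
    (augmentation_simpIncl.{u₁, v₁, w₁} Ψ x a)).trans (h.trans ?_)
  -- The cocone was built from vertices, so its leg at `x 0` gives `f` on the summand of `vertex (x
  -- 0)` rather than on that of `x`.
  exact congrArg f.hom (simpIncl_vertex_eq.{u₁, v₁, w₁} Ψ x a)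

/-- The augmentation exhibits the colimit as the cokernel of the differential from degree one to
degree zero of the homotopy colimit. -/
noncomputable def augmentationIsCokernel :
    IsColimit (CokernelCofork.ofπ (augmentation.{u₁, v₁, w₁} Ψ) (d_augmentation.{u₁, v₁, w₁} Ψ)) :=
  CokernelCofork.IsColimit.ofπ _ _
    (fun f hf => colimit.desc Ψ (coconeOfMap.{u₁, v₁, w₁} Ψ f hf))
    (fun f hf => augmentation_desc.{u₁, v₁, w₁} Ψ f hf)
    (fun f hf _ hm => augmentation_ext.{u₁, v₁, w₁} Ψ
      (hm.trans (augmentation_desc.{u₁, v₁, w₁} Ψ f hf).symm))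

/-! ### Homology in degree zero. -/

/-- The zeroth homology of the homotopy colimit is the colimit. -/
theorem exists_homology_zero_iso_colimit :
    ∃ φ : (hocolim.{u₁, v₁, w₁} Ψ).homology 0 ≅ colimit Ψ,
      (hocolim.{u₁, v₁, w₁} Ψ).homologyπ 0 ≫ φ.hom =
        (hocolim.{u₁, v₁, w₁} Ψ).iCycles 0 ≫ augmentation.{u₁, v₁, w₁} Ψ := by
  let K := hocolim.{u₁, v₁, w₁} Ψ
  have hK := K.opcyclesIsCokernel 1 0 (by simp)
  -- No nonzero differential leaves degree zero, so the inclusion of homology into opcycles (chains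
  -- modulo boundaries) is an isomorphism there. The opcycles and the colimit are then two cokernels
  -- of the same differential.
  refine ⟨ChainComplex.isoHomologyι₀ K ≪≫
    hK.coconePointUniqueUpToIso (augmentationIsCokernel.{u₁, v₁, w₁} Ψ), ?_⟩
  -- At the object `one` of the parallel pair, the cofork legs are the projections from degree zero,
  -- so this says that the comparison isomorphism carries the projection to opcycles to the
  -- augmentation.
  have h := hK.comp_coconePointUniqueUpToIso_hom (augmentationIsCokernel.{u₁, v₁, w₁} Ψ)
    WalkingParallelPair.one
  -- Passing from cycles to homology and then into opcycles is the same as including cycles into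
  -- chains and projecting to opcycles.
  refine (K.homology_π_ι_assoc 0 _).trans ?_
  exact congrArg (K.iCycles 0 ≫ ·) h

end Hocolim

end DiskLike

/-- In degree zero every chain is a cycle, so the displayed equation says that the class of `a` in
`ψ(x)` goes to the image of `a` in the colimit. Since the projection from cycles to homology is epi,
this determines `φ`. -/
theorem theorem15 {R : Type w} [CommRing R] {n : ℕ} (C : NCat.{u, v, w} R n)
    {W : Type u} [TopologicalSpace W] (hW : IsMfd n W)
    (c : C.UC (n - 1) (bd n W)) :
    ∃ φ : (C.blobComplex c).homology 0 ≅ C.skeinModule c,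
      (C.blobComplex c).homologyπ 0 ≫ φ.hom =
        (C.blobComplex c).iCycles 0 ≫ augmentation.{u + 1, v, w} (C.psi c) :=
  exists_homology_zero_iso_colimit.{u + 1, v, w} (C.psi c)
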